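/- Let $\mathsf H$ be a finite-dimensional complex Hilbert space, let $\|A\|_1=\operatorname{Tr}\sqrt{A^\dagger A}$ be the trace norm and let $T(\rho,\sigma)=\tfrac12\|\rho-\sigma\|_1$ be the trace distance. A state is a positive semidefinite operator of trace one. For a subspace $\mathsf S\subseteq\mathsf H$, let $\operatorname{End}(\mathsf S)\oplus 0$ be the set of operators on $\mathsf H$ with range in $\mathsf S$ that vanish on $\mathsf S^\perp$. *Noise.* Let $E_1,\dots,E_N$ be operators on $\mathsf H$ and let $\lambda_1,\dots,\lambda_N>0$ satisfy $\sum_\mu\lambda_\mu=N$. Put $$\mathcal L_E(\rho)=\sum_{\mu=1}^N\lambda_\mu\Bigl(E_\mu\rho E_\mu^\dagger-\tfrac12\{E_\mu^\dagger E_\mu,\rho\}\Bigr).$$ The elementary errors are $E_1,\dots,E_N,E_1^\dagger E_1,\dots,E_N^\dagger E_N$. For a finite sequence $\boldsymbol\mu$ of elementary errors let $K_{\boldsymbol\mu}$ be their product, and let the weight $|\boldsymbol\mu|$ be the length of the sequence; the empty sequence has weight $0$ and $K_\emptyset=I$. *Code.* Let $\mathsf C\subseteq\mathsf H$ be a codespace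 of dimension $q\ge 2$ with orthogonal projector $P$, and let $\ell\ge 0$ be an integer such that the Knill–Laflamme condition holds up to weight $\ell$: for all $|\boldsymbol\mu|,|\boldsymbol\nu|\le\ell$ there is a constant $C_{\boldsymbol\mu\boldsymbol\nu}$ with $PK_{\boldsymbol\mu}^\dagger K_{\boldsymbol\nu}P=C_{\boldsymbol\mu\boldsymbol\nu}P$. (The largest such $\ell$ is the error radius of the code.) Let $\mathsf E$ be the span of the vectors $K_{\boldsymbol\mu}|w\rangle$ with $|w\rangle\in\mathsf C$ and $|\boldsymbol\mu|\le\ell$, and let $$\|\mathcal L_E\|_{1\to1,\mathsf E}=\max_{0\ne O\in\operatorname{End}(\mathsf E)\oplus 0}\frac{\|\mathcal L_E(O)\|_1}{\|O\|_1}.$$ *Recovery.* Let $\mathcal L_R$ be a Lindbladian (a generator in Gorini–Kossakowski–Sudarshan–Lindblad form), let $\mathcal R$ be a linear map on operators, and let $\kappa>0$ and $0<\chi<\infty$. Assume: 1. (Convergence) for every state $\rho$ on $\mathsf H$, $e^{\mathcal L_Rt}(\rho)\to\mathcal R(\rho)$ as $t\to\infty$, and $\|e^{\mathcal L_Rt}(\rho)-\mathcal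 R(\rho)\|_1\le\chi e^{-\kappa t}$ for all $t>0$. 2. (Correction) for every state $\rho_0\in\operatorname{End}(\mathsf C)\oplus 0$ and all $|\boldsymbol\mu|,|\boldsymbol\nu|\le\ell$, $\mathcal R(K_{\boldsymbol\mu}\rho_0K_{\boldsymbol\nu}^\dagger)\propto\rho_0$. 3. (Strict error reduction) for all $t\ge0$ and all $|\boldsymbol\mu|,|\boldsymbol\nu|\le\ell$ there are coefficients $a_{\boldsymbol\mu\boldsymbol\nu,\boldsymbol\mu'\boldsymbol\nu'}(t)\in\mathbb C$ such that, for every state $\rho_0\in\operatorname{End}(\mathsf C)\oplus 0$, $$e^{\mathcal L_Rt}(K_{\boldsymbol\mu}\rho_0K_{\boldsymbol\nu}^\dagger)=\sum_{|\boldsymbol\mu'|\le|\boldsymbol\mu|,\ |\boldsymbol\nu'|\le|\boldsymbol\nu|}a_{\boldsymbol\mu\boldsymbol\nu,\boldsymbol\mu'\boldsymbol\nu'}(t)\,K_{\boldsymbol\mu'}\rho_0K_{\boldsymbol\nu'}^\dagger .$$ *Logical errors.* Let $\Delta\ge0$ be the noise rate and $\mathcal L=\mathcal L_R+\Delta\mathcal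 L_E$. Define $$\epsilon(t)=1-\min_{\psi}\operatorname{Tr}\bigl(|\psi\rangle\langle\psi|\,\mathcal R\,e^{\mathcal Lt}(|\psi\rangle\langle\psi|)\bigr),\qquad \delta(t)=1-\min_{\psi_0\perp\psi_1}T\bigl(e^{\mathcal Lt}(|\psi_0\rangle\langle\psi_0|),e^{\mathcal Lt}(|\psi_1\rangle\langle\psi_1|)\bigr),$$ where $\psi$ runs over the unit vectors of $\mathsf C$ and $(\psi_0,\psi_1)$ over the pairs of orthogonal unit vectors of $\mathsf C$. **Theorem.** Let $\eta=(\chi+1)\Delta\|\mathcal L_E\|_{1\to1,\mathsf E}/\kappa$ and $F_\ell(z)=z\,g(\ell,z)-\ell\,g(\ell+1,z)$, where $g(a,z)=\frac1{\Gamma(a)}\int_0^z s^{a-1}e^{-s}\,ds$ for $a>0$ is the regularized lower incomplete Gamma function and $g(0,z)=1$. Then $F_\ell(z)\le z$ for all $z\ge0$, and for all $t\ge0$ $$\epsilon(t),\ \delta(t)\ \le\ \frac1{\chi+1}\,\eta^{\ell+1}F_\ell(\kappa t)\ \le\ \frac1{\chi+1}\,\eta^{\ell+1}\,\kappa t .$$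 -/

import Mathlib

open Filter Topology

namespace AutonomousQEC

noncomputable section

section Operators

variable {H : Type*} [NormedAddCommGroup H] [InnerProductSpace ℂ H] [CompleteSpace H]

/-- Superoperators: linear maps on the operators of `H`. -/
abbrev SuperOp (H : Type*) [NormedAddCommGroup H] [InnerProductSpace ℂ H] : Type _ :=
  (H →L[ℂ] H) →L[ℂ] (H →L[ℂ] H)

/-- The trace of an operator on a finite-dimensional space. -/
def tr (A : H →L[ℂ] H) : ℂ := LinearMap.trace ℂ H (A : H →ₗ[ℂ] H)

/-- The trace norm `‖A‖₁ = Tr √(A† A)`. -/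
def traceNorm (A : H →L[ℂ] H) : ℝ := (tr (CFC.sqrt (star A * A))).re

/-- The trace distance `T(ρ, σ) = ‖ρ - σ‖₁ / 2`. -/
def traceDist (ρ σ : H →L[ℂ] H) : ℝ := traceNorm (ρ - σ) / 2

/-- Density operators: positive semidefinite with unit trace. -/
def IsState (ρ : H →L[ℂ] H) : Prop := ρ.IsPositive ∧ tr ρ = 1

/-- `O ∈ End(S) ⊕ 0`: the operator `O` has range in `S` and vanishes on the orthogonal
complement of `S`. -/
def SupportedIn (S : Submodule ℂ H) (O : H →L[ℂ] H) : Prop :=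
  (∀ x, O x ∈ S) ∧ ∀ x ∈ Sᗮ, O x = 0

/-- Density operators in the codespace `C`. -/
def IsCodeState (C : Submodule ℂ H) (ρ : H →L[ℂ] H) : Prop := IsState ρ ∧ SupportedIn C ρ

/-- `|ψ⟩⟨ψ|`. -/
def ketbra (ψ : H) : H →L[ℂ] H := InnerProductSpace.rankOne ℂ ψ ψ

/-- The dissipator `ρ ↦ F ρ F† - ½ {F† F, ρ}` of the jump operator `F`. -/
def dissipator (F : H →L[ℂ] H) : SuperOp H where
  toFun ρ := F * ρ * star F - (1 / 2 : ℂ) • (star F * F * ρ + ρ * (star F * F))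
  map_add' ρ σ := by
    simp only [mul_add, add_mul, smul_add]
    abel
  map_smul' c ρ := by
    simp only [mul_smul_comm, smul_mul_assoc, RingHom.id_apply, smul_sub, smul_add,
      smul_comm c (1 / 2 : ℂ)]
  cont := by fun_prop

/-- The Hamiltonian part `ρ ↦ -i [A, ρ]`. -/
def hamiltonianPart (A : H →L[ℂ] H) : SuperOp H where
  toFun ρ := (-Complex.I) • (A * ρ - ρ * A)
  map_add' ρ σ := by
    simp only [mul_add, add_mul, smul_add, smul_sub]
    abel
  map_smul' c ρ := by
    simp only [mul_smul_comm, smul_mul_assoc, RingHom.id_apply, smul_sub,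
      smul_comm c (-Complex.I)]
  cont := by fun_prop

/-- Lindbladians: generators in Gorini-Kossakowski-Sudarshan-Lindblad form. -/
def IsLindbladian (L : SuperOp H) : Prop :=
  ∃ (A : H →L[ℂ] H) (m : ℕ) (F : Fin m → (H →L[ℂ] H)),
    IsSelfAdjoint A ∧ L = hamiltonianPart A + ∑ j, dissipator (F j)

/-- The evolution superoperator `exp (L t)`. -/
def evol (L : SuperOp H) (t : ℝ) : SuperOp H := NormedSpace.exp ((t : ℂ) • L)

/-- The contraction norm `‖L‖_{1 → 1, S}`: the largest value of `‖L(O)‖₁ / ‖O‖₁` over the nonzero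
operators `O ∈ End(S) ⊕ 0`. -/
def restrictedNorm (L : SuperOp H) (S : Submodule ℂ H) : ℝ :=
  sSup {r : ℝ | ∃ O : H →L[ℂ] H, O ≠ 0 ∧ SupportedIn S O ∧ r = traceNorm (L O) / traceNorm O}

end Operators

section Model

variable {H : Type*} [NormedAddCommGroup H] [InnerProductSpace ℂ H] [CompleteSpace H]

/-- An error model: `N` error operators with positive weights of total weight `N`. -/
structure ErrorModel (H : Type*) [NormedAddCommGroup H] [InnerProductSpace ℂ H] where
  N : ℕ
  E : Fin N → (H →L[ℂ] H)
  lam : Fin N → ℝ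
  lam_pos : ∀ μ, 0 < lam μ
  lam_sum : ∑ μ, lam μ = N

namespace ErrorModel

/-- The error Lindbladian `ρ ↦ ∑ λ_μ (E_μ ρ E_μ† - ½ {E_μ† E_μ, ρ})`. -/
def lindbladian (M : ErrorModel H) : SuperOp H :=
  ∑ μ, (M.lam μ : ℂ) • dissipator (M.E μ)

/-- Labels of the elementary errors. -/
abbrev Label (M : ErrorModel H) : Type := Fin M.N ⊕ Fin M.N

/-- The elementary errors `E_μ` and `E_μ† E_μ`. -/
def elem (M : ErrorModel H) : M.Label → (H →L[ℂ] H)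
  | Sum.inl μ => M.E μ
  | Sum.inr μ => star (M.E μ) * M.E μ

/-- The accumulated error `K_{μ₁} ⋯ K_{μ_k}` of a sequence of elementary errors; its weight is the
length of the sequence, and the empty sequence gives the identity. -/
def K (M : ErrorModel H) (w : List M.Label) : H →L[ℂ] H := (w.map M.elem).prod

/-- The Knill-Laflamme condition `P K_μ† K_ν P = C_{μν} P` for all errors of weight at most `l`,
where `P` is the orthogonal projector on the codespace. -/
def KnillLaflamme (M : ErrorModel H) (C : Submodule ℂ H) [C.HasOrthogonalProjection] (l : ℕ) :
    Prop :=
  ∀ μ ν : List M.Label, μ.length ≤ l → ν.length ≤ l →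
    ∃ c : ℂ, C.starProjection * (star (M.K μ) * M.K ν) * C.starProjection = c • C.starProjection

/-- The correctable error space, spanned by the vectors `K_μ |w⟩` with `|w⟩` in the codespace and
`K_μ` an error of weight at most `l`. -/
def errorSpace (M : ErrorModel H) (C : Submodule ℂ H) (l : ℕ) : Submodule ℂ H :=
  Submodule.span ℂ {x | ∃ μ : List M.Label, μ.length ≤ l ∧ ∃ w ∈ C, x = M.K μ w}

/-- The map `R` corrects all errors of weight at most `l`: `R(K_μ ρ₀ K_ν†) ∝ ρ₀` for all states
`ρ₀` in the codespace. -/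
def Corrects (M : ErrorModel H) (C : Submodule ℂ H) (l : ℕ) (R : SuperOp H) : Prop :=
  ∀ ρ₀, IsCodeState C ρ₀ → ∀ μ ν : List M.Label, μ.length ≤ l → ν.length ≤ l →
    ∃ c : ℂ, R (M.K μ * ρ₀ * star (M.K ν)) = c • ρ₀

/-- The recovery dynamics is strictly error-reducing on the errors of weight at most `l`: for all
`t ≥ 0`, `exp (L_R t)(K_μ ρ₀ K_ν†)` is a combination of terms `K_μ' ρ₀ K_ν'†` with `|μ'| ≤ |μ|` and
`|ν'| ≤ |ν|`, with coefficients that do not depend on the state `ρ₀` in the codespace. -/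
def StrictlyErrorReducing (M : ErrorModel H) (C : Submodule ℂ H) (l : ℕ) (LR : SuperOp H) :
    Prop :=
  ∀ t : ℝ, 0 ≤ t → ∀ μ ν : List M.Label, μ.length ≤ l → ν.length ≤ l →
    ∃ a : (List M.Label × List M.Label) →₀ ℂ,
      (∀ p ∈ a.support, p.1.length ≤ μ.length ∧ p.2.length ≤ ν.length) ∧
      ∀ ρ₀, IsCodeState C ρ₀ →
        evol LR t (M.K μ * ρ₀ * star (M.K ν)) =
          a.sum fun p c => c • (M.K p.1 * ρ₀ * star (M.K p.2))

end ErrorModel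

/-- The recovery dynamics generated by `LR` converges at rate `κ` with prefactor `χ`, and its limit
map is `R`. -/
def ConvergesTo (LR R : SuperOp H) (κ χ : ℝ) : Prop :=
  ∀ ρ, IsState ρ →
    Tendsto (fun t : ℝ => evol LR t ρ) atTop (𝓝 (R ρ)) ∧
    ∀ t : ℝ, 0 < t → traceNorm (evol LR t ρ - R ρ) ≤ χ * Real.exp (-κ * t)

/-- The logical error measure `ε(t) = 1 - min Tr(|ψ⟩⟨ψ| R exp(Lt) |ψ⟩⟨ψ|)` over the pure states in
the codespace. -/
def epsilon (C : Submodule ℂ H) (L R : SuperOp H) (t : ℝ) : ℝ :=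
  1 - sInf {r : ℝ | ∃ ψ ∈ C, ‖ψ‖ = 1 ∧ r = (tr (ketbra ψ * R (evol L t (ketbra ψ)))).re}

/-- The logical error measure `δ(t) = 1 - min T(exp(Lt) |ψ₀⟩⟨ψ₀|, exp(Lt) |ψ₁⟩⟨ψ₁|)` over the pairs
of orthogonal pure states in the codespace. -/
def delta (C : Submodule ℂ H) (L : SuperOp H) (t : ℝ) : ℝ :=
  1 - sInf {r : ℝ | ∃ ψ₀ ∈ C, ∃ ψ₁ ∈ C, ‖ψ₀‖ = 1 ∧ ‖ψ₁‖ = 1 ∧ inner ℂ ψ₀ ψ₁ = 0 ∧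
    r = traceDist (evol L t (ketbra ψ₀)) (evol L t (ketbra ψ₁))}

end Model

/-- The regularized lower incomplete Gamma function `g(a, z) = γ(a, z) / Γ(a)` for `a > 0`,
with its continuous extension `g(0, z) = 1`. -/
def regGamma (a z : ℝ) : ℝ :=
  if a = 0 then 1 else (∫ s in (0 : ℝ)..z, s ^ (a - 1) * Real.exp (-s)) / Real.Gamma a

/-- `F_ℓ(z) = z g(ℓ, z) - ℓ g(ℓ + 1, z)`. -/
def F (l : ℕ) (z : ℝ) : ℝ := z * regGamma l z - l * regGamma (l + 1) z

end

end AutonomousQEC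

/-! Expand `exp((L_R + Δ L_E) t) ρ` in powers of `Δ` (Dyson series) up to order `ℓ`, with an exact
remainder. The order-`k` term `D_k` is built by alternating recovery flow and noise. Noise raises
the weight of accumulated errors by at most one and the recovery flow never raises it, so `D_k` is a
combination of `K_μ ρ K_ν†` of weight at most `k`.

As long as the weight is at most `ℓ`, recovery sends such an operator, if self-adjoint, to its trace
times `ρ`. Since `D_0` has trace one and the later terms have trace zero, recovery of the truncated
series gives back exactly `ρ`: only the remainder contributes to the logical error.

The remainder is controlled by `D_ℓ`. For `k < ℓ` the operator `L_E D_k` is still correctable and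
traceless, so recovery kills it and the recovery flow damps it like `χ exp(-κ t)`. Every order thus
costs a factor `χ ‖L_E‖ / κ` and one convolution with `κ exp(-κ t)`, the density of an exponential
waiting time. Iterating yields the probability that a Poisson variable of mean `κ s` is at least `k`
(`traceNorm_dysonTerm_le`), which is the regularized Gamma function. The last factor `L_E` is not
damped; trace-norm contraction of the full evolution leaves the time integral of the Poisson tail,
which is `F_ℓ` (`exists_recovered_eq_add`). Finally `epsilon_le` and `delta_le` convert a recovered
state `ρ + Y` with small `‖Y‖₁` into bounds on the two error measures. -/

namespace AutonomousQEC

/-! ### Trace norm of self-adjoint operators -/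

section TraceNorm

variable {H : Type*} [NormedAddCommGroup H] [InnerProductSpace ℂ H]

theorem tr_add (A B : H →L[ℂ] H) : tr (A + B) = tr A + tr B := by simp [tr]

theorem tr_sub (A B : H →L[ℂ] H) : tr (A - B) = tr A - tr B := by simp [tr]

theorem tr_smul (c : ℂ) (A : H →L[ℂ] H) : tr (c • A) = c * tr A := by simp [tr]

theorem tr_mul_comm (A B : H →L[ℂ] H) : tr (A * B) = tr (B * A) :=
  LinearMap.trace_mul_comm ℂ (A : H →ₗ[ℂ] H) (B : H →ₗ[ℂ] H)

open scoped ComplexOrder in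
theorem tr_nonneg {A : H →L[ℂ] H} (hA : 0 ≤ A) : 0 ≤ tr A :=
  ((ContinuousLinearMap.isPositive_toLinearMap_iff A).2
    ((ContinuousLinearMap.nonneg_iff_isPositive A).1 hA)).trace_nonneg

open scoped ComplexOrder in
theorem re_tr_nonneg {A : H →L[ℂ] H} (hA : 0 ≤ A) : 0 ≤ (tr A).re :=
  (Complex.le_def.1 (tr_nonneg hA)).1

open scoped ComplexOrder in
theorem tr_eq_re {A : H →L[ℂ] H} (hA : 0 ≤ A) : tr A = ((tr A).re : ℂ) :=
  Complex.ext rfl (by simpa using (Complex.le_def.1 (tr_nonneg hA)).2.symm)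

section Complete

variable [CompleteSpace H]

theorem traceNorm_eq_abs (A : H →L[ℂ] H) : traceNorm A = (tr (CFC.abs A)).re := rfl

theorem isSelfAdjoint_intervalIntegral {f : ℝ → (H →L[ℂ] H)} (hf : Continuous f) {a b : ℝ}
    (hab : a ≤ b) (hs : ∀ u ∈ Set.Icc a b, IsSelfAdjoint (f u)) :
    IsSelfAdjoint (∫ u in a..b, f u) := by
  let T : (H →L[ℂ] H) →L[ℝ] (H →L[ℂ] H) := (starL' ℝ : (H →L[ℂ] H) ≃L[ℝ] (H →L[ℂ] H))
  have h := T.intervalIntegral_comp_comm (hf.intervalIntegrable (μ := MeasureTheory.volume) a b)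
  have h' : T (∫ u in a..b, f u) = star (∫ u in a..b, f u) := rfl
  rw [isSelfAdjoint_iff, ← h', ← h]
  refine intervalIntegral.integral_congr fun u hu => ?_
  rw [Set.uIcc_of_le hab] at hu
  exact hs u hu

theorem traceNorm_of_nonneg {A : H →L[ℂ] H} (hA : 0 ≤ A) : traceNorm A = (tr A).re := by
  rw [traceNorm_eq_abs, CFC.abs_of_nonneg A hA]

theorem traceNorm_eq_posPart_add_negPart {A : H →L[ℂ] H} (hA : IsSelfAdjoint A) :
    traceNorm A = (tr A⁺).re + (tr A⁻).re := by
  rw [traceNorm_eq_abs, ← CFC.posPart_add_negPart A hA, tr_add, Complex.add_re]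

theorem traceNorm_smul_of_nonneg {c : ℝ} (hc : 0 ≤ c) (A : H →L[ℂ] H) :
    traceNorm ((c : ℂ) • A) = c * traceNorm A := by
  have h : CFC.abs ((c : ℂ) • A) = (c : ℂ) • CFC.abs A := by
    rw [CFC.abs_smul]
    simp [abs_of_nonneg hc]
  rw [traceNorm_eq_abs, h, tr_smul, Complex.re_ofReal_mul, traceNorm_eq_abs]

end Complete

/-- The trace as a continuous linear functional. -/
noncomputable def trL (H : Type*) [NormedAddCommGroup H] [InnerProductSpace ℂ H]
    [FiniteDimensional ℂ H] : (H →L[ℂ] H) →L[ℂ] ℂ :=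
  LinearMap.toContinuousLinearMap
    { toFun := tr
      map_add' := tr_add
      map_smul' := tr_smul }

variable [FiniteDimensional ℂ H]

@[simp]
theorem trL_apply (A : H →L[ℂ] H) : trL H A = tr A := rfl

variable [CompleteSpace H]

omit [CompleteSpace H] in
theorem norm_le_re_tr {A : H →L[ℂ] H} (hA : 0 ≤ A) : ‖A‖ ≤ (tr A).re := by
  obtain ⟨m, u, rfl⟩ := ContinuousLinearMap.isPositive_iff_eq_sum_rankOne.1
    ((ContinuousLinearMap.nonneg_iff_isPositive A).1 hA)
  have h : ∀ x : H, tr (InnerProductSpace.rankOne ℂ x x) = inner ℂ x x := fun x =>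
    InnerProductSpace.trace_rankOne x x
  refine (norm_sum_le _ _).trans ?_
  rw [← trL_apply, map_sum, Complex.re_sum]
  refine Finset.sum_le_sum fun i _ => ?_
  rw [trL_apply, h, InnerProductSpace.norm_rankOne, ← sq]
  exact (inner_self_eq_norm_sq (𝕜 := ℂ) (u i)).ge

omit [FiniteDimensional ℂ H] in
theorem re_tr_mul_nonneg {P A : H →L[ℂ] H} (hP : IsStarProjection P) (hA : 0 ≤ A) :
    0 ≤ (tr (P * A)).re := by
  have h : tr (P * A) = tr (P * A * star P) := by
    rw [tr_mul_comm (P * A), ← mul_assoc, hP.isSelfAdjoint.star_eq, hP.isIdempotentElem.eq]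
  rw [h]
  exact re_tr_nonneg (star_right_conjugate_nonneg hA P)

omit [FiniteDimensional ℂ H] in
theorem re_tr_mul_le {P A : H →L[ℂ] H} (hP : IsStarProjection P) (hA : 0 ≤ A) :
    (tr (P * A)).re ≤ (tr A).re := by
  have h := re_tr_mul_nonneg hP.one_sub hA
  rw [sub_mul, one_mul, tr_sub, Complex.sub_re] at h
  linarith

omit [FiniteDimensional ℂ H] in
theorem traceNorm_nonneg (A : H →L[ℂ] H) : 0 ≤ traceNorm A := re_tr_nonneg (CFC.abs_nonneg A)

omit [FiniteDimensional ℂ H] in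
@[simp]
theorem traceNorm_zero : traceNorm (0 : H →L[ℂ] H) = 0 := by
  rw [traceNorm_of_nonneg le_rfl]; simp [tr]

theorem norm_le_traceNorm (A : H →L[ℂ] H) : ‖A‖ ≤ traceNorm A := by
  rw [← CFC.norm_abs (a := A)]
  exact norm_le_re_tr (CFC.abs_nonneg A)

theorem traceNorm_le_norm (A : H →L[ℂ] H) : traceNorm A ≤ ‖trL H‖ * ‖A‖ := by
  rw [← CFC.norm_abs (a := A)]
  exact (Complex.re_le_norm _).trans ((trL H).le_opNorm _)

theorem traceNorm_pos {A : H →L[ℂ] H} (hA : A ≠ 0) : 0 < traceNorm A :=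
  (norm_pos_iff.2 hA).trans_le (norm_le_traceNorm A)

omit [FiniteDimensional ℂ H] in
/-- Orthogonal projections probe the trace norm from below. -/
theorem re_tr_reflection_mul_le {P A : H →L[ℂ] H} (hP : IsStarProjection P)
    (hA : IsSelfAdjoint A) : (tr ((2 * P - 1) * A)).re ≤ traceNorm A := by
  rw [traceNorm_eq_posPart_add_negPart hA]
  have e : (2 * P - 1) * A = (P * A⁺ + P * A⁺ - A⁺) - (P * A⁻ + P * A⁻ - A⁻) := by
    nth_rw 1 [← CFC.posPart_sub_negPart A hA]
    noncomm_ring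
  rw [e]
  simp only [tr_add, tr_sub, Complex.add_re, Complex.sub_re]
  linarith [re_tr_mul_nonneg hP (CFC.negPart_nonneg A), re_tr_mul_le hP (CFC.posPart_nonneg A)]

omit [FiniteDimensional ℂ H] in
-- Only the negative part of `A` can lower `Tr(P A)`, and by at most its trace. This bounds the
-- fidelity loss in `epsilon_le`.
theorem re_tr_mul_le_traceNorm {P A : H →L[ℂ] H} (hP : IsStarProjection P)
    (hA : IsSelfAdjoint A) : -traceNorm A ≤ (tr (P * A)).re := by
  rw [traceNorm_eq_posPart_add_negPart hA]
  have e : P * A = P * A⁺ - P * A⁻ := by rw [← mul_sub, CFC.posPart_sub_negPart A hA]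
  rw [e, tr_sub, Complex.sub_re]
  linarith [re_tr_mul_nonneg hP (CFC.posPart_nonneg A), re_tr_mul_le hP (CFC.negPart_nonneg A),
    re_tr_nonneg (CFC.posPart_nonneg A)]

omit [FiniteDimensional ℂ H] in
/-- The trace norm of a self-adjoint operator is attained on a reflection. -/
theorem exists_traceNorm_eq {A : H →L[ℂ] H} (hA : IsSelfAdjoint A) :
    ∃ P : H →L[ℂ] H, IsStarProjection P ∧ traceNorm A = (tr ((2 * P - 1) * A)).re := by
  -- The kernel of `A⁻` contains the range of `A⁺` and is orthogonal to the range of `A⁻`, so the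
  -- reflection in it acts as a sign of `A`.
  let S : Submodule ℂ H := LinearMap.ker (A⁻ : H →L[ℂ] H).toLinearMap
  have hP : IsStarProjection S.starProjection := isStarProjection_starProjection
  have h1 : S.starProjection * A⁺ = A⁺ := by
    ext x
    refine Submodule.starProjection_eq_self_iff.2 (LinearMap.mem_ker.2 ?_)
    exact congrArg (fun T : H →L[ℂ] H => T x) (CFC.negPart_mul_posPart A)
  have h2 : A⁻ * S.starProjection = 0 := by
    ext x
    exact LinearMap.mem_ker.1 (Submodule.starProjection_apply_mem S x)
  have h3 : S.starProjection * A⁻ = 0 := by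
    have := congrArg star h2
    rwa [star_mul, star_zero, hP.isSelfAdjoint.star_eq,
      (IsSelfAdjoint.of_nonneg (CFC.negPart_nonneg A)).star_eq] at this
  refine ⟨S.starProjection, hP, ?_⟩
  have e : (2 * S.starProjection - 1) * A = A⁺ + A⁻ := by
    have : (2 * S.starProjection - 1) * (A⁺ - A⁻) = 2 * (S.starProjection * A⁺)
      - 2 * (S.starProjection * A⁻) - A⁺ + A⁻ := by noncomm_ring
    rw [h1, h3, CFC.posPart_sub_negPart A hA] at this
    rw [this]
    noncomm_ring
  rw [e, traceNorm_eq_posPart_add_negPart hA, tr_add, Complex.add_re]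

omit [FiniteDimensional ℂ H] in
theorem traceNorm_sub_le_of_nonneg {A B : H →L[ℂ] H} (hA : 0 ≤ A) (hB : 0 ≤ B) :
    traceNorm (A - B) ≤ (tr A).re + (tr B).re := by
  obtain ⟨P, hP, h⟩ := exists_traceNorm_eq
    ((IsSelfAdjoint.of_nonneg hA).sub (IsSelfAdjoint.of_nonneg hB))
  have e : (2 * P - 1) * (A - B) = (P * A + P * A - A) - (P * B + P * B - B) := by noncomm_ring
  rw [h, e]
  simp only [tr_add, tr_sub, Complex.add_re, Complex.sub_re]
  linarith [re_tr_mul_nonneg hP hB, re_tr_mul_le hP hA]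

omit [FiniteDimensional ℂ H] in
theorem traceNorm_sub_le {A B : H →L[ℂ] H} (hA : IsSelfAdjoint A) (hB : IsSelfAdjoint B) :
    traceNorm (A - B) ≤ traceNorm A + traceNorm B := by
  obtain ⟨P, hP, h⟩ := exists_traceNorm_eq (hA.sub hB)
  have hN : traceNorm B = traceNorm (-B) := by simp [traceNorm]
  have e : (2 * P - 1) * (A - B) = (2 * P - 1) * A + (2 * P - 1) * (-B) := by noncomm_ring
  rw [h, e, tr_add, Complex.add_re, hN]
  exact add_le_add (re_tr_reflection_mul_le hP hA) (re_tr_reflection_mul_le hP hB.neg)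

/-- The reflection attaining the trace norm of the integral gives a linear functional that passes
under the integral sign. The pointwise bound is asked only on the open interval because the
convergence hypothesis concerns strictly positive times. -/
theorem traceNorm_intervalIntegral_le {f : ℝ → (H →L[ℂ] H)} (hf : Continuous f) {g : ℝ → ℝ}
    (hg : Continuous g) {a b : ℝ} (hab : a ≤ b) (hs : ∀ u ∈ Set.Icc a b, IsSelfAdjoint (f u))
    (hfg : ∀ u ∈ Set.Ioo a b, traceNorm (f u) ≤ g u) :
    traceNorm (∫ u in a..b, f u) ≤ ∫ u in a..b, g u := by
  obtain ⟨P, hP, h⟩ := exists_traceNorm_eq (isSelfAdjoint_intervalIntegral hf hab hs)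
  let T : (H →L[ℂ] H) →L[ℝ] ℝ := Complex.reCLM ∘L
    ((trL H).restrictScalars ℝ) ∘L ((ContinuousLinearMap.mul ℂ (H →L[ℂ] H) (2 * P - 1)).restrictScalars ℝ)
  have hT : ∀ A, T A = (tr ((2 * P - 1) * A)).re := fun A => rfl
  rw [h, ← hT, ← T.intervalIntegral_comp_comm (hf.intervalIntegrable _ _)]
  refine intervalIntegral.integral_mono_on_of_le_Ioo hab
    ((T.continuous.comp hf).intervalIntegrable _ _) (hg.intervalIntegrable _ _) fun u hu => ?_
  exact (re_tr_reflection_mul_le hP (hs u (Set.Ioo_subset_Icc_self hu))).trans (hfg u hu)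

/-- In finite dimension `S` is closed, so the quotient map is continuous and commutes with the
integral. -/
theorem intervalIntegral_mem_submodule (S : Submodule ℂ (H →L[ℂ] H)) {f : ℝ → (H →L[ℂ] H)}
    (hf : Continuous f) {a b : ℝ} (hab : a ≤ b) (hs : ∀ u ∈ Set.Icc a b, f u ∈ S) :
    (∫ u in a..b, f u) ∈ S := by
  have : IsClosed (S : Set (H →L[ℂ] H)) := S.closed_of_finiteDimensional
  rw [← Submodule.Quotient.mk_eq_zero]
  change S.mkQL _ = 0
  rw [← S.mkQL.intervalIntegral_comp_comm (hf.intervalIntegrable _ _)]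
  rw [intervalIntegral.integral_congr (g := fun _ => 0), intervalIntegral.integral_zero]
  intro u hu
  rw [Set.uIcc_of_le hab] at hu
  exact (Submodule.Quotient.mk_eq_zero S).2 (hs u hu)

/-- Needed because the real `sSup` of an unbounded set is `0`; finite dimension makes the trace and
operator norms comparable. -/
theorem bddAbove_restrictedNorm (L : SuperOp H) (S : Submodule ℂ H) :
    BddAbove {r : ℝ | ∃ O : H →L[ℂ] H, O ≠ 0 ∧ SupportedIn S O ∧
      r = traceNorm (L O) / traceNorm O} := by
  refine ⟨‖trL H‖ * ‖L‖, ?_⟩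
  rintro _ ⟨O, hO, -, rfl⟩
  rw [div_le_iff₀ (traceNorm_pos hO)]
  calc traceNorm (L O) ≤ ‖trL H‖ * ‖L O‖ := traceNorm_le_norm _
    _ ≤ ‖trL H‖ * (‖L‖ * traceNorm O) := by
      gcongr
      exact (L.le_opNorm O).trans (by gcongr; exact norm_le_traceNorm O)
    _ = _ := by ring

theorem traceNorm_le_restrictedNorm_mul (L : SuperOp H) {S : Submodule ℂ H} {O : H →L[ℂ] H}
    (hO : SupportedIn S O) : traceNorm (L O) ≤ restrictedNorm L S * traceNorm O := by
  by_cases h : O = 0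
  · simp [h]
  · rw [← div_le_iff₀ (traceNorm_pos h)]
    exact le_csSup (bddAbove_restrictedNorm L S) ⟨O, h, hO, rfl⟩

omit [FiniteDimensional ℂ H] in
theorem restrictedNorm_nonneg (L : SuperOp H) (S : Submodule ℂ H) : 0 ≤ restrictedNorm L S := by
  refine Real.sSup_nonneg ?_
  rintro _ ⟨O, -, -, rfl⟩
  exact div_nonneg (traceNorm_nonneg _) (traceNorm_nonneg _)

end TraceNorm

/-! ### One-parameter groups and their positivity -/

section Flow

variable {E : Type*} [NormedAddCommGroup E] [NormedSpace ℂ E]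

/-- The one-parameter group generated by a bounded operator. -/
noncomputable def flow (L : E →L[ℂ] E) (t : ℝ) : E →L[ℂ] E := NormedSpace.exp ((t : ℂ) • L)

theorem flow_neg (L : E →L[ℂ] E) (t : ℝ) : flow (-L) t = flow L (-t) := by
  simp [flow]

theorem flow_zero (L : E →L[ℂ] E) : flow L 0 = 1 := by
  simp [flow]

variable [CompleteSpace E]

theorem flow_add (L : E →L[ℂ] E) (s t : ℝ) : flow L (s + t) = flow L s * flow L t := by
  let _ : NormedAlgebra ℚ (E →L[ℂ] E) := NormedAlgebra.restrictScalars ℚ ℂ (E →L[ℂ] E)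
  rw [flow, flow, flow, ← NormedSpace.exp_add_of_commute, Complex.ofReal_add, add_smul]
  exact ((Commute.refl L).smul_left _).smul_right _

theorem hasDerivAt_flow (L : E →L[ℂ] E) (t : ℝ) : HasDerivAt (flow L) (L * flow L t) t := by
  have h := (hasDerivAt_exp_smul_const' L (t : ℂ)).scomp t
    (Complex.ofRealCLM.hasDerivAt (x := t))
  rw [Complex.ofRealCLM_apply, Complex.ofReal_one, one_smul] at h
  exact h

theorem flow_mul_comm (L : E →L[ℂ] E) (t : ℝ) : flow L t * L = L * flow L t :=
  (hasDerivAt_exp_smul_const L (t : ℂ)).unique (hasDerivAt_exp_smul_const' L (t : ℂ))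

theorem hasDerivAt_flow_apply (L : E →L[ℂ] E) {f : ℝ → E} {f' : E} {t : ℝ}
    (hf : HasDerivAt f f' t) :
    HasDerivAt (fun u => flow L u (f u)) (L (flow L t (f t)) + flow L t f') t :=
  ((ContinuousLinearMap.restrictScalarsL ℂ E E ℝ ℝ).hasFDerivAt.comp_hasDerivAt t
    (hasDerivAt_flow L t)).clm_apply hf

section Order

variable [PartialOrder E] [IsOrderedAddMonoid E] [PosSMulMono ℝ E] [OrderClosedTopology E]

omit [CompleteSpace E] [IsOrderedAddMonoid E] [OrderClosedTopology E] in
theorem complex_smul_nonneg {c : ℝ} (hc : 0 ≤ c) {x : E} (hx : 0 ≤ x) : 0 ≤ (c : ℂ) • x := by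
  rw [Complex.coe_smul]
  exact smul_nonneg hc hx

theorem exp_smul_apply_nonneg {Φ : E →L[ℂ] E} (hΦ : ∀ x, 0 ≤ x → 0 ≤ Φ x) {c : ℝ}
    (hc : 0 ≤ c) {x : E} (hx : 0 ≤ x) : 0 ≤ NormedSpace.exp ((c : ℂ) • Φ) x := by
  have hpow : ∀ n : ℕ, 0 ≤ (Φ ^ n) x := by
    intro n
    induction n with
    | zero => simpa using hx
    | succ n ih => rw [pow_succ']; exact hΦ _ ih
  have h := (NormedSpace.exp_series_hasSum_exp' (𝕂 := ℂ) ((c : ℂ) • Φ)).mapL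
    (ContinuousLinearMap.apply ℂ E x)
  refine h.nonneg fun n => ?_
  have e : ((n.factorial : ℂ)⁻¹ • ((c : ℂ) • Φ) ^ n) x =
      (((n.factorial : ℝ)⁻¹ * c ^ n : ℝ) : ℂ) • (Φ ^ n) x := by
    rw [smul_pow, smul_smul]
    push_cast
    rfl
  change 0 ≤ ((n.factorial : ℂ)⁻¹ • ((c : ℂ) • Φ) ^ n) x
  rw [e]
  exact complex_smul_nonneg (by positivity) (hpow n)

/-- If `1 + h L` is positive up to a second order term, the flow of `L` is positive: `L` is the
limit of `h⁻¹ ((1 + h L + h² Q) - 1)`, whose flow is a damped exponential of a positive map. -/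
theorem flow_apply_nonneg {L Q : E →L[ℂ] E}
    (hLQ : ∀ h : ℝ, 0 < h → ∀ x, 0 ≤ x → 0 ≤ (1 + (h : ℂ) • L + (h * h : ℂ) • Q) x) {t : ℝ}
    (ht : 0 ≤ t) {x : E} (hx : 0 ≤ x) : 0 ≤ flow L t x := by
  let _ : NormedAlgebra ℚ (E →L[ℂ] E) := NormedAlgebra.restrictScalars ℚ ℂ (E →L[ℂ] E)
  have hexp : ∀ h : ℝ, 0 < h → 0 ≤ NormedSpace.exp ((t : ℂ) • (L + (h : ℂ) • Q)) x := by
    intro h hh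
    -- The scalar part commutes with the rest, so the exponential factors into that of a positive
    -- map and the number `exp(-t/h)`.
    have e : (t : ℂ) • (L + (h : ℂ) • Q) =
        ((t / h : ℝ) : ℂ) • (1 + (h : ℂ) • L + (h * h : ℂ) • Q) + (-(t / h : ℝ) : ℂ) • 1 := by
      have h1 : ((t / h : ℝ) : ℂ) * h = t := by
        rw [← Complex.ofReal_mul, div_mul_cancel₀ _ hh.ne']
      simp only [smul_add, smul_smul, neg_smul, ← mul_assoc, h1]
      abel
    have e1 : NormedSpace.exp ((-(t / h : ℝ) : ℂ) • (1 : E →L[ℂ] E)) =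
        (Real.exp (-(t / h)) : ℂ) • 1 := by
      have := NormedSpace.algebraMap_exp_comm (𝔸 := E →L[ℂ] E) (-(t / h : ℝ) : ℂ)
      rw [Algebra.algebraMap_eq_smul_one, Algebra.algebraMap_eq_smul_one] at this
      rw [← this, ← Complex.exp_eq_exp_ℂ, Complex.ofReal_exp, Complex.ofReal_neg]
    rw [e, NormedSpace.exp_add_of_commute ((Commute.one_right _).smul_right _), e1, mul_smul_comm,
      mul_one]
    exact complex_smul_nonneg (Real.exp_nonneg _)
      (exp_smul_apply_nonneg (hLQ h hh) (div_nonneg ht hh.le) hx)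
  have hlim : Tendsto (fun h : ℝ => NormedSpace.exp ((t : ℂ) • (L + (h : ℂ) • Q)) x) (𝓝[>] 0)
      (𝓝 (flow L t x)) := by
    have hc : Continuous fun h : ℝ => NormedSpace.exp ((t : ℂ) • (L + (h : ℂ) • Q)) x := by
      fun_prop
    have := hc.tendsto 0
    rw [Complex.ofReal_zero, zero_smul, add_zero] at this
    exact this.mono_left nhdsWithin_le_nhds
  exact ge_of_tendsto hlim (eventually_mem_nhdsWithin.mono fun h hh => hexp h hh)

end Order

end Flow

/-! ### Evolution superoperators -/

section Evolution

variable {H : Type*} [NormedAddCommGroup H] [InnerProductSpace ℂ H] [CompleteSpace H]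

theorem evol_eq_flow (L : SuperOp H) (t : ℝ) : evol L t = flow L t := rfl

@[simp]
theorem evol_zero (L : SuperOp H) : evol L 0 = 1 := flow_zero L

theorem evol_add_apply (L : SuperOp H) (s t : ℝ) (A : H →L[ℂ] H) :
    evol L (s + t) A = evol L s (evol L t A) := by
  rw [evol_eq_flow, flow_add]; rfl

theorem evol_apply_comm (L : SuperOp H) (t : ℝ) (A : H →L[ℂ] H) :
    evol L t (L A) = L (evol L t A) :=
  congrArg (fun T : SuperOp H => T A) (flow_mul_comm L t)

theorem hasDerivAt_evol_apply (L : SuperOp H) {f : ℝ → (H →L[ℂ] H)} {f' : H →L[ℂ] H} {t : ℝ}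
    (hf : HasDerivAt f f' t) :
    HasDerivAt (fun u => evol L u (f u)) (L (evol L t (f t)) + evol L t f') t :=
  hasDerivAt_flow_apply L hf

theorem continuous_evol (L : SuperOp H) : Continuous (evol L) :=
  continuous_iff_continuousAt.2 fun t => (hasDerivAt_flow L t).continuousAt

theorem tr_evol_apply [FiniteDimensional ℂ H] {L : SuperOp H} (hL : ∀ A, tr (L A) = 0) (t : ℝ)
    (A : H →L[ℂ] H) : tr (evol L t A) = tr A := by
  have h : ∀ u, HasDerivAt (fun u => tr (evol L u A)) 0 u := fun u => by
    have h1 := hasDerivAt_evol_apply L (hasDerivAt_const u A)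
    have h2 := ((trL H).restrictScalars ℝ).hasFDerivAt.comp_hasDerivAt u h1
    have h3 : tr (L (evol L u A) + evol L u 0) = 0 := by rw [map_zero, add_zero, hL]
    rw [← h3]
    exact h2
  have := is_const_of_deriv_eq_zero (fun u => (h u).differentiableAt) (fun u => (h u).deriv) t 0
  simpa using this

end Evolution

/-! ### Lindbladians generate positive, trace-preserving evolutions -/

section Positivity

variable {H : Type*} [NormedAddCommGroup H] [InnerProductSpace ℂ H]

/-- Positive superoperators. -/
def PreservesNonneg (Φ : SuperOp H) : Prop := ∀ A, 0 ≤ A → 0 ≤ Φ A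

variable [CompleteSpace H]

/-- Superoperators of the form `ρ ↦ A ρ + ρ A† + Φ(ρ)` with a positive superoperator `Φ`. -/
def GeneratesPositive (L : SuperOp H) : Prop :=
  ∃ (A : H →L[ℂ] H) (Φ : SuperOp H), PreservesNonneg Φ ∧ ∀ X, L X = A * X + X * star A + Φ X

theorem PreservesNonneg.isSelfAdjoint {Φ : SuperOp H} (hΦ : PreservesNonneg Φ) {A : H →L[ℂ] H}
    (hA : IsSelfAdjoint A) : IsSelfAdjoint (Φ A) := by
  rw [← CFC.posPart_sub_negPart A hA, map_sub]
  exact (IsSelfAdjoint.of_nonneg (hΦ _ (CFC.posPart_nonneg A))).sub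
    (IsSelfAdjoint.of_nonneg (hΦ _ (CFC.negPart_nonneg A)))

/-- A positive trace preserving superoperator contracts the trace norm of self-adjoint
operators. -/
theorem PreservesNonneg.traceNorm_le [FiniteDimensional ℂ H] {Φ : SuperOp H}
    (hΦ : PreservesNonneg Φ)
    (htr : ∀ A, 0 ≤ A → tr (Φ A) = tr A) {A : H →L[ℂ] H} (hA : IsSelfAdjoint A) :
    traceNorm (Φ A) ≤ traceNorm A := by
  rw [traceNorm_eq_posPart_add_negPart hA]
  nth_rw 1 [← CFC.posPart_sub_negPart A hA]
  rw [map_sub, ← htr _ (CFC.posPart_nonneg A), ← htr _ (CFC.negPart_nonneg A)]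
  exact traceNorm_sub_le_of_nonneg (hΦ _ (CFC.posPart_nonneg A)) (hΦ _ (CFC.negPart_nonneg A))

theorem GeneratesPositive.add {L L' : SuperOp H} (h : GeneratesPositive L)
    (h' : GeneratesPositive L') : GeneratesPositive (L + L') := by
  obtain ⟨A, Φ, hΦ, hL⟩ := h
  obtain ⟨A', Φ', hΦ', hL'⟩ := h'
  refine ⟨A + A', Φ + Φ', fun X hX => add_nonneg (hΦ X hX) (hΦ' X hX), fun X => ?_⟩
  simp only [add_apply, hL, hL', star_add, add_mul, mul_add]
  abel

theorem GeneratesPositive.zero : GeneratesPositive (0 : SuperOp H) :=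
  ⟨0, 0, fun _ _ => le_rfl, fun X => by simp⟩

theorem GeneratesPositive.sum {ι : Type*} (s : Finset ι) {L : ι → SuperOp H}
    (h : ∀ i ∈ s, GeneratesPositive (L i)) : GeneratesPositive (∑ i ∈ s, L i) :=
  Finset.sum_induction _ GeneratesPositive (fun _ _ => GeneratesPositive.add)
    GeneratesPositive.zero h

theorem GeneratesPositive.smul {L : SuperOp H} (h : GeneratesPositive L) {c : ℝ} (hc : 0 ≤ c) :
    GeneratesPositive ((c : ℂ) • L) := by
  obtain ⟨A, Φ, hΦ, hL⟩ := h
  refine ⟨(c : ℂ) • A, (c : ℂ) • Φ, fun X hX => complex_smul_nonneg hc (hΦ X hX), fun X => ?_⟩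
  simp [hL, star_smul]

theorem generatesPositive_dissipator (F : H →L[ℂ] H) : GeneratesPositive (dissipator F) := by
  refine ⟨-((1 / 2 : ℂ) • (star F * F)),
    (ContinuousLinearMap.mul ℂ (H →L[ℂ] H)).flip (star F) * ContinuousLinearMap.mul ℂ _ F,
    fun X hX => star_right_conjugate_nonneg hX F, fun X => ?_⟩
  have h : star (-((1 / 2 : ℂ) • (star F * F))) = -((1 / 2 : ℂ) • (star F * F)) := by
    simp [star_smul]
  rw [h]
  change F * X * star F - (1 / 2 : ℂ) • (star F * F * X + X * (star F * F)) =
    -((1 / 2 : ℂ) • (star F * F)) * X + X * -((1 / 2 : ℂ) • (star F * F)) + F * X * star F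
  simp only [neg_mul, mul_neg, smul_mul_assoc, mul_smul_comm, smul_add]
  abel

theorem generatesPositive_hamiltonianPart {A : H →L[ℂ] H} (hA : IsSelfAdjoint A) :
    GeneratesPositive (hamiltonianPart A) := by
  refine ⟨(-Complex.I) • A, 0, fun _ _ => le_rfl, fun X => ?_⟩
  change (-Complex.I) • (A * X - X * A) = _
  simp [star_smul, hA.star_eq, sub_eq_add_neg]

/-- The second-order term `Q X = A X A†` completes `X + h (A X + X A†)` to the conjugation `(1 + h
A) X (1 + h A)†`, so `flow_apply_nonneg` applies. -/
theorem GeneratesPositive.preservesNonneg_evol {L : SuperOp H} (hL : GeneratesPositive L) {t : ℝ}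
    (ht : 0 ≤ t) : PreservesNonneg (evol L t) := by
  obtain ⟨A, Φ, hΦ, hLA⟩ := hL
  let Q : SuperOp H :=
    (ContinuousLinearMap.mul ℂ (H →L[ℂ] H)).flip (star A) * ContinuousLinearMap.mul ℂ _ A
  have hQ : ∀ X, Q X = A * X * star A := fun X => rfl
  refine fun X hX => flow_apply_nonneg (Q := Q) (fun h hh X hX => ?_) ht hX
  have e : (1 + (h : ℂ) • L + (h * h : ℂ) • Q) X =
      (1 + (h : ℂ) • A) * X * star (1 + (h : ℂ) • A) + (h : ℂ) • Φ X := by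
    simp only [add_apply, smul_apply, hLA, hQ, one_apply_eq_self, star_add, star_one, star_smul,
      RCLike.star_def, Complex.conj_ofReal, add_mul, mul_add, one_mul, mul_one, smul_mul_assoc,
      mul_smul_comm, smul_add, smul_smul]
    abel
  rw [e]
  exact add_nonneg (star_right_conjugate_nonneg hX _) (complex_smul_nonneg hh.le (hΦ X hX))

theorem GeneratesPositive.isSelfAdjoint {L : SuperOp H} (hL : GeneratesPositive L)
    {X : H →L[ℂ] H} (hX : IsSelfAdjoint X) : IsSelfAdjoint (L X) := by
  obtain ⟨A, Φ, hΦ, hLA⟩ := hL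
  rw [hLA]
  refine IsSelfAdjoint.add ?_ (hΦ.isSelfAdjoint hX)
  rw [isSelfAdjoint_iff, star_add, star_mul, star_mul, star_star, hX.star_eq, add_comm]

theorem tr_dissipator (F X : H →L[ℂ] H) : tr (dissipator F X) = 0 := by
  change tr (F * X * star F - (1 / 2 : ℂ) • (star F * F * X + X * (star F * F))) = 0
  rw [tr_sub, tr_smul, tr_add, tr_mul_comm X, tr_mul_comm (F * X), ← mul_assoc]
  ring

theorem tr_hamiltonianPart (A X : H →L[ℂ] H) : tr (hamiltonianPart A X) = 0 := by
  change tr ((-Complex.I) • (A * X - X * A)) = 0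
  rw [tr_smul, tr_sub, tr_mul_comm X, sub_self, mul_zero]

theorem IsLindbladian.generatesPositive {L : SuperOp H} (hL : IsLindbladian L) :
    GeneratesPositive L := by
  obtain ⟨A, m, F, hA, rfl⟩ := hL
  exact (generatesPositive_hamiltonianPart hA).add
    (GeneratesPositive.sum _ fun j _ => generatesPositive_dissipator (F j))

theorem IsLindbladian.tr_apply [FiniteDimensional ℂ H] {L : SuperOp H} (hL : IsLindbladian L)
    (X : H →L[ℂ] H) : tr (L X) = 0 := by
  obtain ⟨A, m, F, hA, rfl⟩ := hL
  rw [add_apply, tr_add, tr_hamiltonianPart, zero_add,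
    sum_apply, ← trL_apply, map_sum]
  simp [tr_dissipator]

theorem ErrorModel.generatesPositive_lindbladian (M : ErrorModel H) :
    GeneratesPositive M.lindbladian :=
  GeneratesPositive.sum _ fun μ _ => (generatesPositive_dissipator (M.E μ)).smul (M.lam_pos μ).le

theorem ErrorModel.tr_lindbladian_apply [FiniteDimensional ℂ H] (M : ErrorModel H)
    (X : H →L[ℂ] H) : tr (M.lindbladian X) = 0 := by
  rw [ErrorModel.lindbladian, sum_apply, ← trL_apply, map_sum]
  simp [tr_dissipator]

end Positivity

/-! ### Poisson tails, the incomplete Gamma function and `F` -/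

section IncompleteGamma

/-- The probability that a Poisson variable of mean `z` is at least `k`. -/
noncomputable def poissonTail (k : ℕ) (z : ℝ) : ℝ :=
  1 - Real.exp (-z) * ∑ j ∈ Finset.range k, z ^ j / j.factorial

theorem poissonTail_zero (z : ℝ) : poissonTail 0 z = 1 := by simp [poissonTail]

theorem poissonTail_succ (k : ℕ) (z : ℝ) :
    poissonTail (k + 1) z = poissonTail k z - z ^ k * Real.exp (-z) / k.factorial := by
  rw [poissonTail, poissonTail, Finset.sum_range_succ]
  ring

theorem poissonTail_succ_apply_zero (k : ℕ) : poissonTail (k + 1) 0 = 0 := by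
  rw [poissonTail, Finset.sum_range_succ']
  simp

theorem hasDerivAt_poissonTail_succ (k : ℕ) (z : ℝ) :
    HasDerivAt (poissonTail (k + 1)) (z ^ k * Real.exp (-z) / k.factorial) z := by
  have he : HasDerivAt (fun z : ℝ => Real.exp (-z)) (-Real.exp (-z)) z := by
    simpa using (hasDerivAt_neg z).exp
  induction k with
  | zero =>
    have : poissonTail 1 = fun z => 1 - Real.exp (-z) := by
      ext z; simp [poissonTail]
    rw [this]
    simpa using he.const_sub 1
  | succ k ih =>
    have h : poissonTail (k + 2) = fun z =>
        poissonTail (k + 1) z - z ^ (k + 1) * Real.exp (-z) / (k + 1).factorial :=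
      funext fun z => poissonTail_succ (k + 1) z
    rw [h]
    refine (ih.sub (((hasDerivAt_pow (k + 1) z).mul he).div_const _)).congr_deriv ?_
    rw [Nat.factorial_succ]
    push_cast
    have := Nat.factorial_ne_zero k
    field_simp
    ring

theorem continuous_poissonTail (k : ℕ) : Continuous (poissonTail k) := by
  unfold poissonTail
  fun_prop

theorem poissonTail_le_one (k : ℕ) {z : ℝ} (hz : 0 ≤ z) : poissonTail k z ≤ 1 :=
  sub_le_self _ (by positivity)

theorem poissonTail_nonneg (k : ℕ) {z : ℝ} (hz : 0 ≤ z) : 0 ≤ poissonTail k z := by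
  have h : Real.exp (-z) * ∑ j ∈ Finset.range k, z ^ j / j.factorial ≤
      Real.exp (-z) * Real.exp z :=
    mul_le_mul_of_nonneg_left (Real.sum_le_exp_of_nonneg hz k) (Real.exp_nonneg _)
  rw [← Real.exp_add, neg_add_cancel, Real.exp_zero] at h
  exact sub_nonneg.2 h

/-- Both sides vanish at `0` and have derivative `z ^ k * exp (-z) / k!`. -/
theorem regGamma_natCast_succ (k : ℕ) (z : ℝ) : regGamma (k + 1) z = poissonTail (k + 1) z := by
  have h0 : (k + 1 : ℝ) ≠ 0 := by positivity
  have hf : (k.factorial : ℝ) ≠ 0 := by exact_mod_cast k.factorial_ne_zero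
  rw [regGamma, if_neg h0, Real.Gamma_nat_eq_factorial, div_eq_iff hf]
  have hc : Continuous fun s : ℝ => s ^ k * Real.exp (-s) := by fun_prop
  have hd : ∀ s : ℝ, HasDerivAt (fun s => poissonTail (k + 1) s * k.factorial)
      (s ^ k * Real.exp (-s)) s := fun s => by
    simpa [div_mul_cancel₀ _ hf] using (hasDerivAt_poissonTail_succ k s).mul_const (k.factorial : ℝ)
  have h := intervalIntegral.integral_eq_sub_of_hasDerivAt (a := 0) (b := z)
    (fun s _ => hd s) (hc.intervalIntegrable _ _)
  rw [poissonTail_succ_apply_zero, zero_mul, sub_zero] at h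
  rw [← h]
  refine intervalIntegral.integral_congr fun s _ => ?_
  simp only [add_sub_cancel_right, Real.rpow_natCast]

theorem regGamma_natCast (k : ℕ) (z : ℝ) : regGamma k z = poissonTail k z := by
  cases k with
  | zero => simp [regGamma, poissonTail_zero]
  | succ k => rw [← regGamma_natCast_succ, Nat.cast_succ]

theorem F_eq (l : ℕ) (z : ℝ) : F l z = z * poissonTail l z - l * poissonTail (l + 1) z := by
  rw [F, regGamma_natCast, regGamma_natCast_succ]

theorem F_le_self (l : ℕ) {z : ℝ} (hz : 0 ≤ z) : F l z ≤ z := by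
  rw [F_eq]
  have h1 := mul_le_of_le_one_right hz (poissonTail_le_one l hz)
  have h2 : 0 ≤ (l : ℝ) * poissonTail (l + 1) z :=
    mul_nonneg l.cast_nonneg (poissonTail_nonneg _ hz)
  linarith

theorem F_zero (l : ℕ) : F l 0 = 0 := by
  rw [F_eq, poissonTail_succ_apply_zero]; ring

/-- The derivatives of the two tails cancel, since `z * z ^ (l - 1) / (l - 1)! = l * z ^ l / l!` for
`l ≥ 1`. Hence `F l` is the integral of the Poisson tail, which is how it enters the remainder
bound. -/
theorem hasDerivAt_F (l : ℕ) (z : ℝ) : HasDerivAt (F l) (poissonTail l z) z := by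
  rw [funext (F_eq l)]
  cases l with
  | zero => simpa [poissonTail_zero] using hasDerivAt_id' z
  | succ k =>
    refine (((hasDerivAt_id z).mul (hasDerivAt_poissonTail_succ k z)).sub
      ((hasDerivAt_poissonTail_succ (k + 1) z).const_mul ((k + 1 : ℕ) : ℝ))).congr_deriv ?_
    rw [Nat.factorial_succ]
    push_cast
    have := Nat.factorial_ne_zero k
    simp only [id]
    field_simp
    ring

theorem integral_poissonTail {κ : ℝ} (hκ : κ ≠ 0) (l : ℕ) (t : ℝ) :
    ∫ s in (0 : ℝ)..t, poissonTail l (κ * s) = F l (κ * t) / κ := by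
  have hd : ∀ s : ℝ, HasDerivAt (fun s => F l (κ * s) / κ) (poissonTail l (κ * s)) s := fun s => by
    have := ((hasDerivAt_F l (κ * s)).comp s ((hasDerivAt_id s).const_mul κ)).div_const κ
    simpa [hκ, Function.comp_def] using this
  rw [intervalIntegral.integral_eq_sub_of_hasDerivAt (fun s _ => hd s)
    (((continuous_poissonTail l).comp (continuous_const_mul κ)).intervalIntegrable _ _)]
  simp [F_zero]

theorem F_nonneg (l : ℕ) {z : ℝ} (hz : 0 ≤ z) : 0 ≤ F l z := by
  have h := integral_poissonTail one_ne_zero l z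
  simp only [one_mul, div_one] at h
  rw [← h]
  exact intervalIntegral.integral_nonneg hz fun s hs => poissonTail_nonneg l hs.1

/-- For `κ > 0`, the `(k+1)`-st arrival of a Poisson process is the `k`-th plus an independent
exponential waiting time. This is the induction step of the Dyson estimate. -/
theorem integral_exp_mul_poissonTail {κ : ℝ} (hκ : κ ≠ 0) (k : ℕ) (s : ℝ) :
    ∫ u in (0 : ℝ)..s, Real.exp (-κ * (s - u)) * poissonTail k (κ * u) =
      poissonTail (k + 1) (κ * s) / κ := by
  have hd : ∀ u : ℝ, HasDerivAt
      (fun u => Real.exp (-κ * (s - u)) * (poissonTail (k + 1) (κ * u) / κ))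
      (Real.exp (-κ * (s - u)) * poissonTail k (κ * u)) u := fun u => by
    have h1 : HasDerivAt (fun u => poissonTail (k + 1) (κ * u) / κ)
        ((κ * u) ^ k * Real.exp (-(κ * u)) / k.factorial) u := by
      have := ((hasDerivAt_poissonTail_succ k (κ * u)).comp u
        ((hasDerivAt_id u).const_mul κ)).div_const κ
      simpa [hκ, Function.comp_def] using this
    have h2 : HasDerivAt (fun u => Real.exp (-κ * (s - u))) (Real.exp (-κ * (s - u)) * κ) u := by
      simpa using (((hasDerivAt_id u).const_sub s).const_mul (-κ)).exp
    refine (h2.mul h1).congr_deriv ?_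
    -- The density term from `h1` restores the tail from index `k + 1` to index `k`.
    rw [poissonTail_succ]
    field_simp
    ring
  have hc : Continuous fun u : ℝ => Real.exp (-κ * (s - u)) * poissonTail k (κ * u) :=
    (by fun_prop : Continuous fun u : ℝ => Real.exp (-κ * (s - u))).mul
      ((continuous_poissonTail k).comp (continuous_const_mul κ))
  rw [intervalIntegral.integral_eq_sub_of_hasDerivAt (fun u _ => hd u)
    (hc.intervalIntegrable _ _)]
  simp [poissonTail_succ_apply_zero]

end IncompleteGamma

/-! ### Operators spanned by accumulated errors of bounded weight -/

section AccumulatedErrors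

variable {H : Type*} [NormedAddCommGroup H] [InnerProductSpace ℂ H] [CompleteSpace H]

/-- The span of the operators `K_μ ρ K_ν†` with errors of weight at most `k`. -/
def errorSpan (M : ErrorModel H) (ρ : H →L[ℂ] H) (k : ℕ) : Submodule ℂ (H →L[ℂ] H) :=
  Submodule.span ℂ {X | ∃ μ ν : List M.Label, μ.length ≤ k ∧ ν.length ≤ k ∧
    X = M.K μ * ρ * star (M.K ν)}

theorem mul_mem_errorSpan (M : ErrorModel H) (ρ : H →L[ℂ] H) {k : ℕ} {μ ν : List M.Label}
    (hμ : μ.length ≤ k) (hν : ν.length ≤ k) : M.K μ * ρ * star (M.K ν) ∈ errorSpan M ρ k :=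
  Submodule.subset_span ⟨μ, ν, hμ, hν, rfl⟩

theorem errorSpan_mono (M : ErrorModel H) (ρ : H →L[ℂ] H) {k m : ℕ} (h : k ≤ m) :
    errorSpan M ρ k ≤ errorSpan M ρ m :=
  Submodule.span_mono fun _ ⟨μ, ν, hμ, hν, e⟩ => ⟨μ, ν, hμ.trans h, hν.trans h, e⟩

theorem self_mem_errorSpan (M : ErrorModel H) (ρ : H →L[ℂ] H) (k : ℕ) : ρ ∈ errorSpan M ρ k := by
  simpa [ErrorModel.K] using
    mul_mem_errorSpan M ρ (μ := []) (ν := []) (Nat.zero_le k) (Nat.zero_le k)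

theorem ErrorModel.K_cons (M : ErrorModel H) (a : M.Label) (μ : List M.Label) :
    M.K (a :: μ) = M.elem a * M.K μ := by simp [ErrorModel.K]

theorem map_mem_of_mem_errorSpan {M : ErrorModel H} {ρ : H →L[ℂ] H} {k : ℕ} {T : SuperOp H}
    {S : Submodule ℂ (H →L[ℂ] H)}
    (h : ∀ μ ν : List M.Label, μ.length ≤ k → ν.length ≤ k → T (M.K μ * ρ * star (M.K ν)) ∈ S)
    {X : H →L[ℂ] H} (hX : X ∈ errorSpan M ρ k) : T X ∈ S := by
  have : errorSpan M ρ k ≤ S.comap (T : (H →L[ℂ] H) →ₗ[ℂ] (H →L[ℂ] H)) :=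
    Submodule.span_le.2 fun _ ⟨μ, ν, hμ, hν, e⟩ => e ▸ h μ ν hμ hν
  exact this hX

/-- The jump term prepends `E_i` on both sides and the anticommutator prepends `E_i† E_i` on one
side. Counting `E_i† E_i` as a single elementary error keeps the increase at one. -/
theorem lindbladian_mem_errorSpan {M : ErrorModel H} {ρ : H →L[ℂ] H} {k : ℕ} {X : H →L[ℂ] H}
    (hX : X ∈ errorSpan M ρ k) : M.lindbladian X ∈ errorSpan M ρ (k + 1) := by
  refine map_mem_of_mem_errorSpan (fun μ ν hμ hν => ?_) hX
  rw [ErrorModel.lindbladian, sum_apply]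
  refine Submodule.sum_mem _ fun i _ => Submodule.smul_mem _ _ ?_
  have hc : ∀ (a : M.Label) (w : List M.Label), w.length ≤ k → (a :: w).length ≤ k + 1 :=
    fun a w hw => by simpa using hw
  have h1 := mul_mem_errorSpan M ρ (hc (Sum.inl i) μ hμ) (hc (Sum.inl i) ν hν)
  have h2 := mul_mem_errorSpan M ρ (hc (Sum.inr i) μ hμ) (hν.trans k.le_succ)
  have h3 := mul_mem_errorSpan M ρ (hμ.trans k.le_succ) (hc (Sum.inr i) ν hν)
  have e : dissipator (M.E i) (M.K μ * ρ * star (M.K ν)) =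
      M.K (Sum.inl i :: μ) * ρ * star (M.K (Sum.inl i :: ν)) - (1 / 2 : ℂ) •
        (M.K (Sum.inr i :: μ) * ρ * star (M.K ν) + M.K μ * ρ * star (M.K (Sum.inr i :: ν))) := by
    simp only [ErrorModel.K_cons, ErrorModel.elem, star_mul, star_star, ← mul_assoc]
    simp only [dissipator, ContinuousLinearMap.coe_mk', LinearMap.coe_mk, AddHom.coe_mk,
      ← mul_assoc]
  change dissipator (M.E i) (M.K μ * ρ * star (M.K ν)) ∈ _
  rw [e]
  exact Submodule.sub_mem _ h1 (Submodule.smul_mem _ _ (Submodule.add_mem _ h2 h3))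

theorem ErrorModel.StrictlyErrorReducing.evol_mem_errorSpan {M : ErrorModel H}
    {C : Submodule ℂ H} {l : ℕ} {LR : SuperOp H} (h : M.StrictlyErrorReducing C l LR)
    {ρ : H →L[ℂ] H} (hρ : IsCodeState C ρ) {k : ℕ} (hk : k ≤ l) {t : ℝ} (ht : 0 ≤ t)
    {X : H →L[ℂ] H} (hX : X ∈ errorSpan M ρ k) : evol LR t X ∈ errorSpan M ρ k := by
  refine map_mem_of_mem_errorSpan (fun μ ν hμ hν => ?_) hX
  obtain ⟨a, ha, h⟩ := h t ht μ ν (hμ.trans hk) (hν.trans hk)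
  rw [h ρ hρ]
  exact Submodule.sum_mem _ fun p hp => Submodule.smul_mem _ _
    (mul_mem_errorSpan M ρ ((ha p hp).1.trans hμ) ((ha p hp).2.trans hν))

theorem ErrorModel.Corrects.exists_smul {M : ErrorModel H} {C : Submodule ℂ H} {l : ℕ}
    {R : SuperOp H} (h : M.Corrects C l R) {ρ : H →L[ℂ] H} (hρ : IsCodeState C ρ)
    {X : H →L[ℂ] H} (hX : X ∈ errorSpan M ρ l) : ∃ c : ℂ, R X = c • ρ := by
  have : R X ∈ Submodule.span ℂ {ρ} := by
    refine map_mem_of_mem_errorSpan (fun μ ν hμ hν => ?_) hX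
    obtain ⟨c, hc⟩ := h ρ hρ μ ν hμ hν
    exact Submodule.mem_span_singleton.2 ⟨c, hc.symm⟩
  obtain ⟨c, hc⟩ := Submodule.mem_span_singleton.1 this
  exact ⟨c, hc.symm⟩

theorem supportedIn_of_mem_errorSpan {M : ErrorModel H} {C : Submodule ℂ H} {ρ : H →L[ℂ] H}
    (hρ : SupportedIn C ρ) {l : ℕ} {X : H →L[ℂ] H} (hX : X ∈ errorSpan M ρ l) :
    SupportedIn (M.errorSpace C l) X := by
  induction hX using Submodule.span_induction with
  | zero => exact ⟨fun _ => Submodule.zero_mem _, fun _ _ => rfl⟩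
  | add X Y _ _ hX hY =>
    refine ⟨fun x => Submodule.add_mem _ (hX.1 x) (hY.1 x), fun x hx => ?_⟩
    rw [add_apply, hX.2 x hx, hY.2 x hx, add_zero]
  | smul c X _ hX =>
    refine ⟨fun x => Submodule.smul_mem _ _ (hX.1 x), fun x hx => ?_⟩
    rw [smul_apply, hX.2 x hx, smul_zero]
  | mem X hX =>
    obtain ⟨μ, ν, hμ, hν, rfl⟩ := hX
    refine ⟨fun x => Submodule.subset_span ⟨μ, hμ, _, hρ.1 _, rfl⟩, fun x hx => ?_⟩
    -- By adjunction: `x` is orthogonal to `K_ν w` for every `w` in the codespace.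
    have h : star (M.K ν) x ∈ Cᗮ := by
      refine (Submodule.mem_orthogonal _ _).2 fun w hw => ?_
      rw [ContinuousLinearMap.star_eq_adjoint, ContinuousLinearMap.adjoint_inner_right]
      exact (Submodule.mem_orthogonal _ _).1 hx _ (Submodule.subset_span ⟨ν, hν, w, hw, rfl⟩)
    change M.K μ (ρ (star (M.K ν) x)) = 0
    rw [hρ.2 _ h, map_zero]

end AccumulatedErrors

/-! ### The recovery map as a limit of the recovery flow -/

section Recovery

variable {H : Type*} [NormedAddCommGroup H] [InnerProductSpace ℂ H] [FiniteDimensional ℂ H]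
  [CompleteSpace H]

theorem IsState.nonneg {H : Type*} [NormedAddCommGroup H] [InnerProductSpace ℂ H]
    {ρ : H →L[ℂ] H} (hρ : IsState ρ) : 0 ≤ ρ :=
  (ContinuousLinearMap.nonneg_iff_isPositive ρ).2 hρ.1

theorem exists_state_of_nonneg {A : H →L[ℂ] H} (hA : 0 ≤ A) (h0 : A ≠ 0) :
    ∃ ρ, IsState ρ ∧ A = ((tr A).re : ℂ) • ρ := by
  have hp : 0 < (tr A).re := (norm_pos_iff.2 h0).trans_le (norm_le_re_tr hA)
  have hp' : ((tr A).re : ℂ) ≠ 0 := by exact_mod_cast hp.ne'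
  refine ⟨(((tr A).re)⁻¹ : ℝ) • A, ⟨?_, ?_⟩, ?_⟩
  · exact (ContinuousLinearMap.nonneg_iff_isPositive _).1 (smul_nonneg (inv_nonneg.2 hp.le) hA)
  · rw [← Complex.coe_smul, tr_smul]
    nth_rw 2 [tr_eq_re hA]
    rw [Complex.ofReal_inv, inv_mul_cancel₀ hp']
  · rw [← Complex.coe_smul, smul_smul, Complex.ofReal_inv, mul_inv_cancel₀ hp', one_smul]

namespace ConvergesTo

variable {LR R : SuperOp H} {κ χ : ℝ}

theorem isState (h : ConvergesTo LR R κ χ) (hLR : IsLindbladian LR) {ρ : H →L[ℂ] H}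
    (hρ : IsState ρ) : IsState (R ρ) := by
  have hlim := (h ρ hρ).1
  refine ⟨(ContinuousLinearMap.nonneg_iff_isPositive _).1 (ge_of_tendsto hlim
    ((eventually_ge_atTop 0).mono fun t ht =>
      hLR.generatesPositive.preservesNonneg_evol ht ρ hρ.nonneg)), ?_⟩
  refine tendsto_nhds_unique (((trL H).continuous.tendsto _).comp hlim) ?_
  refine tendsto_const_nhds.congr fun t => ?_
  rw [Function.comp_apply, trL_apply, tr_evol_apply hLR.tr_apply, hρ.2]

theorem preservesNonneg (h : ConvergesTo LR R κ χ) (hLR : IsLindbladian LR) :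
    PreservesNonneg R := by
  intro A hA
  by_cases h0 : A = 0
  · simp [h0]
  · obtain ⟨ρ, hρ, e⟩ := exists_state_of_nonneg hA h0
    rw [e, map_smul]
    exact complex_smul_nonneg (re_tr_nonneg hA) (h.isState hLR hρ).nonneg

theorem tr_of_nonneg (h : ConvergesTo LR R κ χ) (hLR : IsLindbladian LR) {A : H →L[ℂ] H}
    (hA : 0 ≤ A) : tr (R A) = tr A := by
  by_cases h0 : A = 0
  · simp [h0]
  · obtain ⟨ρ, hρ, e⟩ := exists_state_of_nonneg hA h0
    rw [e, map_smul, tr_smul, tr_smul, hρ.2, (h.isState hLR hρ).2]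

theorem tr_of_isSelfAdjoint (h : ConvergesTo LR R κ χ) (hLR : IsLindbladian LR)
    {A : H →L[ℂ] H} (hA : IsSelfAdjoint A) : tr (R A) = tr A := by
  rw [← CFC.posPart_sub_negPart A hA, map_sub, tr_sub, tr_sub,
    h.tr_of_nonneg hLR (CFC.posPart_nonneg A), h.tr_of_nonneg hLR (CFC.negPart_nonneg A)]

theorem traceNorm_sub_le_of_nonneg (h : ConvergesTo LR R κ χ) {A : H →L[ℂ] H} (hA : 0 ≤ A) {t : ℝ}
    (ht : 0 < t) :
    traceNorm (evol LR t A - R A) ≤ χ * Real.exp (-κ * t) * (tr A).re := by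
  by_cases h0 : A = 0
  · simp [h0, tr]
  · obtain ⟨ρ, hρ, e⟩ := exists_state_of_nonneg hA h0
    have e' : evol LR t A - R A = ((tr A).re : ℂ) • (evol LR t ρ - R ρ) := by
      rw [smul_sub, ← map_smul, ← map_smul, ← e]
    rw [e', traceNorm_smul_of_nonneg (re_tr_nonneg hA), mul_comm]
    exact mul_le_mul_of_nonneg_right ((h ρ hρ).2 t ht) (re_tr_nonneg hA)

/-- Convergence is assumed on states only. It scales to `A⁺` and `A⁻`, whose traces add up to
`‖A‖₁`, so the constant `χ` is not worsened. -/
theorem traceNorm_sub_le (h : ConvergesTo LR R κ χ) (hLR : IsLindbladian LR) {A : H →L[ℂ] H}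
    (hA : IsSelfAdjoint A) {t : ℝ} (ht : 0 < t) :
    traceNorm (evol LR t A - R A) ≤ χ * Real.exp (-κ * t) * traceNorm A := by
  have hs : ∀ B : H →L[ℂ] H, 0 ≤ B → IsSelfAdjoint (evol LR t B - R B) := fun B hB =>
    (IsSelfAdjoint.of_nonneg (hLR.generatesPositive.preservesNonneg_evol ht.le B hB)).sub
      (IsSelfAdjoint.of_nonneg (h.preservesNonneg hLR B hB))
  have e : evol LR t A - R A = (evol LR t A⁺ - R A⁺) - (evol LR t A⁻ - R A⁻) := by
    nth_rw 1 2 [← CFC.posPart_sub_negPart A hA]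
    rw [map_sub, map_sub]
    abel
  rw [e, traceNorm_eq_posPart_add_negPart hA, mul_add]
  exact (AutonomousQEC.traceNorm_sub_le (hs _ (CFC.posPart_nonneg A))
    (hs _ (CFC.negPart_nonneg A))).trans (add_le_add
      (h.traceNorm_sub_le_of_nonneg (CFC.posPart_nonneg A) ht)
      (h.traceNorm_sub_le_of_nonneg (CFC.negPart_nonneg A) ht))

/-- The recovery map sends the self-adjoint combinations of correctable errors to multiples of the
initial code state. -/
theorem apply_eq_tr_smul (h : ConvergesTo LR R κ χ) (hLR : IsLindbladian LR) {M : ErrorModel H}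
    {C : Submodule ℂ H} {l : ℕ} (hcorr : M.Corrects C l R) {ρ : H →L[ℂ] H}
    (hρ : IsCodeState C ρ) {X : H →L[ℂ] H} (hX : X ∈ errorSpan M ρ l) (hs : IsSelfAdjoint X) :
    R X = tr X • ρ := by
  obtain ⟨c, hc⟩ := hcorr.exists_smul hρ hX
  -- Trace preservation identifies the proportionality constant as `tr X`.
  have ht := h.tr_of_isSelfAdjoint hLR hs
  rw [hc, tr_smul, hρ.1.2, mul_one] at ht
  rw [hc, ht]

end ConvergesTo

end Recovery

/-! ### Dyson expansion with exact remainder -/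

section Dyson

variable {H : Type*} [NormedAddCommGroup H] [InnerProductSpace ℂ H] [CompleteSpace H]

/-- The terms of the Dyson expansion of `exp ((L + Δ V) t) ρ` in powers of `Δ`. -/
noncomputable def dysonTerm (L V : SuperOp H) (ρ : H →L[ℂ] H) : ℕ → ℝ → (H →L[ℂ] H)
  | 0, s => evol L s ρ
  | k + 1, s => evol L s (∫ u in (0 : ℝ)..s, evol L (-u) (V (dysonTerm L V ρ k u)))

theorem continuous_evol_comp (L : SuperOp H) {g : ℝ → ℝ} (hg : Continuous g)
    {f : ℝ → (H →L[ℂ] H)} (hf : Continuous f) : Continuous fun u => evol L (g u) (f u) :=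
  ((continuous_evol L).comp hg).clm_apply hf

theorem continuous_dysonTerm (L V : SuperOp H) (ρ : H →L[ℂ] H) (k : ℕ) :
    Continuous (dysonTerm L V ρ k) := by
  induction k with
  | zero => exact continuous_evol_comp L continuous_id continuous_const
  | succ k ih =>
    exact continuous_evol_comp L continuous_id (intervalIntegral.continuous_primitive
      (fun a b => (continuous_evol_comp L continuous_neg
        (V.continuous.comp ih)).intervalIntegrable a b) 0)

/-- The definition suits differentiation in `s`; this form has only forward propagators, so
positivity, error reduction and decay apply to the integrand. -/
theorem dysonTerm_succ_eq_integral (L V : SuperOp H) (ρ : H →L[ℂ] H) (k : ℕ) (s : ℝ) :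
    dysonTerm L V ρ (k + 1) s =
      ∫ u in (0 : ℝ)..s, evol L (s - u) (V (dysonTerm L V ρ k u)) := by
  rw [dysonTerm, ← (evol L s).intervalIntegral_comp_comm]
  · refine intervalIntegral.integral_congr fun u _ => ?_
    simp only [sub_eq_add_neg, evol_add_apply]
  · exact (continuous_evol_comp L continuous_neg
      (V.continuous.comp (continuous_dysonTerm L V ρ k))).intervalIntegrable _ _

theorem dysonTerm_apply_zero (L V : SuperOp H) (ρ : H →L[ℂ] H) (k : ℕ) :
    dysonTerm L V ρ k 0 = if k = 0 then ρ else 0 := by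
  cases k <;> simp [dysonTerm]

theorem hasDerivAt_dysonTerm_zero (L V : SuperOp H) (ρ : H →L[ℂ] H) (s : ℝ) :
    HasDerivAt (dysonTerm L V ρ 0) (L (dysonTerm L V ρ 0 s)) s := by
  have h := hasDerivAt_evol_apply L (hasDerivAt_const s ρ)
  rw [map_zero, add_zero] at h
  exact h

theorem hasDerivAt_dysonTerm_succ (L V : SuperOp H) (ρ : H →L[ℂ] H) (k : ℕ) (s : ℝ) :
    HasDerivAt (dysonTerm L V ρ (k + 1))
      (L (dysonTerm L V ρ (k + 1) s) + V (dysonTerm L V ρ k s)) s := by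
  have hc : Continuous fun u => evol L (-u) (V (dysonTerm L V ρ k u)) :=
    continuous_evol_comp L continuous_neg (V.continuous.comp (continuous_dysonTerm L V ρ k))
  have h := hasDerivAt_evol_apply L (hc.integral_hasStrictDerivAt 0 s).hasDerivAt
  rw [← evol_add_apply L s (-s), add_neg_cancel, evol_zero, one_apply_eq_self] at h
  exact h

/-- The noise term of each order feeds the next one, so the truncated sum fails the full evolution
equation only by its top-order noise term. -/
theorem hasDerivAt_dyson_sum (L V : SuperOp H) (Δ : ℝ) (ρ : H →L[ℂ] H) (l : ℕ) (s : ℝ) :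
    HasDerivAt (fun s => ∑ k ∈ Finset.range (l + 1), Δ ^ k • dysonTerm L V ρ k s)
      ((L + (Δ : ℂ) • V) (∑ k ∈ Finset.range (l + 1), Δ ^ k • dysonTerm L V ρ k s) -
        Δ ^ (l + 1) • V (dysonTerm L V ρ l s)) s := by
  induction l with
  | zero =>
    simp only [zero_add, Finset.sum_range_one, pow_zero, one_smul, pow_one, add_apply, smul_apply,
      Complex.coe_smul, add_sub_cancel_right]
    exact hasDerivAt_dysonTerm_zero L V ρ s
  | succ l ih =>
    simp only [Finset.sum_range_succ _ (l + 1)]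
    refine (ih.add ((hasDerivAt_dysonTerm_succ L V ρ l s).const_smul (Δ ^ (l + 1)))).congr_deriv ?_
    simp only [map_add, add_apply, smul_apply, smul_add, ← Complex.coe_smul,
      map_smul, smul_smul, Complex.ofReal_pow, pow_succ']
    push_cast
    module

theorem evol_eq_dyson_sum_add_integral (L V : SuperOp H) (Δ : ℝ) (ρ : H →L[ℂ] H) (l : ℕ) (t : ℝ) :
    evol (L + (Δ : ℂ) • V) t ρ =
      ∑ k ∈ Finset.range (l + 1), Δ ^ k • dysonTerm L V ρ k t +
        ∫ s in (0 : ℝ)..t,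
          evol (L + (Δ : ℂ) • V) (t - s) (Δ ^ (l + 1) • V (dysonTerm L V ρ l s)) := by
  set W : SuperOp H := L + (Δ : ℂ) • V with hW
  set S : ℝ → (H →L[ℂ] H) := fun s => ∑ k ∈ Finset.range (l + 1), Δ ^ k • dysonTerm L V ρ k s
    with hS
  have hD := continuous_dysonTerm L V ρ l
  have hneg : ∀ s : ℝ, evol (-W) s = evol W (-s) := fun s => flow_neg W s
  -- Duhamel interpolation: at `s = 0` the curve is the full evolution of `ρ`, at `s = t` the
  -- truncated sum, and its derivative contains only the defect.
  have hder : ∀ s : ℝ, HasDerivAt (fun s => evol W (t - s) (S s))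
      (-evol W (t - s) (Δ ^ (l + 1) • V (dysonTerm L V ρ l s))) s := fun s => by
    have h1 := hasDerivAt_evol_apply (-W) (hasDerivAt_dyson_sum L V Δ ρ l s)
    have h2 := ((evol W t).restrictScalars ℝ).hasFDerivAt.comp_hasDerivAt s h1
    have e : ∀ (u : ℝ) X, evol W (t - u) X = evol W t (evol (-W) u X) := fun u X => by
      rw [hneg, ← evol_add_apply, sub_eq_add_neg]
    simp only [e]
    refine h2.congr_deriv ?_
    rw [← hW, map_sub]
    change evol W t (-(W (evol (-W) s (S s))) + (evol (-W) s (W (S s)) - _)) = _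
    rw [hneg, evol_apply_comm, neg_add_eq_sub, sub_sub_cancel_left, map_neg]
  have hcV : Continuous fun s => Δ ^ (l + 1) • V (dysonTerm L V ρ l s) :=
    (V.continuous.comp hD).const_smul (Δ ^ (l + 1))
  have hc : Continuous fun s => evol W (t - s) (Δ ^ (l + 1) • V (dysonTerm L V ρ l s)) :=
    continuous_evol_comp W (continuous_sub_left t) hcV
  have h := intervalIntegral.integral_eq_sub_of_hasDerivAt (a := 0) (b := t)
    (fun s _ => hder s) (hc.neg.intervalIntegrable _ _)
  have hS0 : S 0 = ρ := by
    simp [hS, dysonTerm_apply_zero]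
  rw [intervalIntegral.integral_neg, sub_self, evol_zero, one_apply_eq_self, sub_zero, hS0] at h
  rw [neg_eq_iff_eq_neg.1 h]
  abel

end Dyson

/-! ### Decay of the Dyson terms and bound on the remainder -/

section Bounds

variable {H : Type*} [NormedAddCommGroup H] [InnerProductSpace ℂ H] [FiniteDimensional ℂ H]
  [CompleteSpace H] {M : ErrorModel H} {C : Submodule ℂ H} {l : ℕ} {LR R : SuperOp H}
  {ρ : H →L[ℂ] H}

theorem dysonTerm_mem_errorSpan (hred : M.StrictlyErrorReducing C l LR) (hρ : IsCodeState C ρ)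
    {k : ℕ} (hk : k ≤ l) {s : ℝ} (hs : 0 ≤ s) :
    dysonTerm LR M.lindbladian ρ k s ∈ errorSpan M ρ k := by
  induction k generalizing s with
  | zero => exact hred.evol_mem_errorSpan hρ hk hs (self_mem_errorSpan M ρ 0)
  | succ k ih =>
    rw [dysonTerm_succ_eq_integral]
    refine intervalIntegral_mem_submodule _ (continuous_evol_comp _ (continuous_sub_left s)
      (M.lindbladian.continuous.comp (continuous_dysonTerm _ _ _ k))) hs fun u hu => ?_
    exact hred.evol_mem_errorSpan hρ hk (sub_nonneg.2 hu.2)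
      (lindbladian_mem_errorSpan (ih (k.le_succ.trans hk) hu.1))

omit [FiniteDimensional ℂ H] in
theorem isSelfAdjoint_dysonTerm (hLR : GeneratesPositive LR) {V : SuperOp H}
    (hV : GeneratesPositive V) (hρ : IsSelfAdjoint ρ) (k : ℕ) {s : ℝ} (hs : 0 ≤ s) :
    IsSelfAdjoint (dysonTerm LR V ρ k s) := by
  induction k generalizing s with
  | zero => exact (hLR.preservesNonneg_evol hs).isSelfAdjoint hρ
  | succ k ih =>
    rw [dysonTerm_succ_eq_integral]
    refine isSelfAdjoint_intervalIntegral (continuous_evol_comp _ (continuous_sub_left s)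
      (V.continuous.comp (continuous_dysonTerm _ _ _ k))) hs fun u hu => ?_
    exact (hLR.preservesNonneg_evol (sub_nonneg.2 hu.2)).isSelfAdjoint
      (hV.isSelfAdjoint (ih hu.1))

theorem tr_dysonTerm_succ {V : SuperOp H} (hLR : ∀ X, tr (LR X) = 0) (hV : ∀ X, tr (V X) = 0)
    (k : ℕ) (s : ℝ) : tr (dysonTerm LR V ρ (k + 1) s) = 0 := by
  rw [dysonTerm_succ_eq_integral, ← trL_apply, ← (trL H).intervalIntegral_comp_comm]
  · simp only [trL_apply, tr_evol_apply hLR, hV, intervalIntegral.integral_zero]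
  · exact (continuous_evol_comp _ (continuous_sub_left s)
      (V.continuous.comp (continuous_dysonTerm _ _ _ k))).intervalIntegrable _ _

variable {κ χ : ℝ}

/-- Under the integral defining the next term, the noise costs a factor `n` and the recovery flow
supplies the decay `χ exp(-κ (s - u))`; the convolution identity then raises the tail index by one.
-/
theorem traceNorm_dysonTerm_le (hLR : IsLindbladian LR) (hκ : 0 < κ) (hχ : 0 < χ)
    (hconv : ConvergesTo LR R κ χ) (hcorr : M.Corrects C l R)
    (hred : M.StrictlyErrorReducing C l LR) (hρ : IsCodeState C ρ)
    {k : ℕ} (hk : k ≤ l) {s : ℝ} (hs : 0 ≤ s) :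
    traceNorm (dysonTerm LR M.lindbladian ρ k s) ≤
      (χ * restrictedNorm M.lindbladian (M.errorSpace C l) / κ) ^ k * poissonTail k (κ * s) := by
  have hLE := M.generatesPositive_lindbladian
  have hsa := IsSelfAdjoint.of_nonneg hρ.1.nonneg
  set n := restrictedNorm M.lindbladian (M.errorSpace C l) with hn
  have hn0 : 0 ≤ n := restrictedNorm_nonneg _ _
  induction k generalizing s with
  | zero =>
    have h0 := hLR.generatesPositive.preservesNonneg_evol hs ρ hρ.1.nonneg
    rw [dysonTerm, traceNorm_of_nonneg h0, tr_evol_apply hLR.tr_apply, hρ.1.2, poissonTail_zero]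
    simp
  | succ k ih =>
    rw [dysonTerm_succ_eq_integral]
    have hk' : k ≤ l := k.le_succ.trans hk
    have hg : Continuous fun u : ℝ => χ * n * (χ * n / κ) ^ k *
        (Real.exp (-κ * (s - u)) * poissonTail k (κ * u)) :=
      continuous_const.mul ((by fun_prop : Continuous fun u : ℝ => Real.exp (-κ * (s - u))).mul
        ((continuous_poissonTail k).comp (continuous_const_mul κ)))
    refine (traceNorm_intervalIntegral_le (continuous_evol_comp _ (continuous_sub_left s)
      (M.lindbladian.continuous.comp (continuous_dysonTerm _ _ _ k))) hg hs
      (fun u hu => (hLR.generatesPositive.preservesNonneg_evol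
        (sub_nonneg.2 hu.2)).isSelfAdjoint (hLE.isSelfAdjoint
          (isSelfAdjoint_dysonTerm hLR.generatesPositive hLE hsa k hu.1)))
      (fun u hu => ?_)).trans_eq ?_
    · set D := dysonTerm LR M.lindbladian ρ k u with hD
      have hDs : IsSelfAdjoint D :=
        isSelfAdjoint_dysonTerm hLR.generatesPositive hLE hsa k hu.1.le
      have hDm : D ∈ errorSpan M ρ k := dysonTerm_mem_errorSpan hred hρ hk' hu.1.le
      -- `L_E D` has weight at most `k + 1 ≤ l`, so it is correctable, and it is traceless.
      have hR : R (M.lindbladian D) = 0 := by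
        rw [hconv.apply_eq_tr_smul hLR hcorr hρ
          (errorSpan_mono M ρ hk (lindbladian_mem_errorSpan hDm)) (hLE.isSelfAdjoint hDs),
          M.tr_lindbladian_apply, zero_smul]
      have h1 := hconv.traceNorm_sub_le hLR (hLE.isSelfAdjoint hDs) (sub_pos.2 hu.2)
      rw [hR, sub_zero] at h1
      have h2 : traceNorm (M.lindbladian D) ≤ n * traceNorm D :=
        traceNorm_le_restrictedNorm_mul _
          (supportedIn_of_mem_errorSpan hρ.2 (errorSpan_mono M ρ hk' hDm))
      calc traceNorm (evol LR (s - u) (M.lindbladian D))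
          ≤ χ * Real.exp (-κ * (s - u)) * (n * ((χ * n / κ) ^ k * poissonTail k (κ * u))) := by
            refine h1.trans (mul_le_mul_of_nonneg_left (h2.trans ?_) (by positivity))
            exact mul_le_mul_of_nonneg_left (ih hk' hu.1.le) hn0
        _ = _ := by ring
    · rw [intervalIntegral.integral_const_mul, integral_exp_mul_poissonTail hκ.ne', pow_succ]
      ring

theorem exists_recovered_eq_add (hLR : IsLindbladian LR) (hκ : 0 < κ) (hχ : 0 < χ)
    (hconv : ConvergesTo LR R κ χ) (hcorr : M.Corrects C l R)
    (hred : M.StrictlyErrorReducing C l LR) (hρ : IsCodeState C ρ) {Δ : ℝ} (hΔ : 0 ≤ Δ)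
    {t : ℝ} (ht : 0 ≤ t) :
    ∃ Y, IsSelfAdjoint Y ∧ R (evol (LR + (Δ : ℂ) • M.lindbladian) t ρ) = ρ + Y ∧
      traceNorm Y ≤ χ ^ l *
        (Δ * restrictedNorm M.lindbladian (M.errorSpace C l) / κ) ^ (l + 1) * F l (κ * t) := by
  have hLE := M.generatesPositive_lindbladian
  have hW := hLR.generatesPositive.add (hLE.smul hΔ)
  have hWtr : ∀ X, tr ((LR + (Δ : ℂ) • M.lindbladian) X) = 0 := fun X => by
    rw [add_apply, smul_apply, tr_add, tr_smul, hLR.tr_apply, M.tr_lindbladian_apply]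
    ring
  have hsa := IsSelfAdjoint.of_nonneg hρ.1.nonneg
  have hDs : ∀ k {s : ℝ}, 0 ≤ s → IsSelfAdjoint (dysonTerm LR M.lindbladian ρ k s) :=
    fun k s hs => isSelfAdjoint_dysonTerm hLR.generatesPositive hLE hsa k hs
  set W := LR + (Δ : ℂ) • M.lindbladian with hWdef
  set n := restrictedNorm M.lindbladian (M.errorSpace C l) with hn
  have hn0 : 0 ≤ n := restrictedNorm_nonneg _ _
  have hcV : Continuous fun s =>
      Δ ^ (l + 1) • M.lindbladian (dysonTerm LR M.lindbladian ρ l s) :=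
    (M.lindbladian.continuous.comp (continuous_dysonTerm _ _ _ l)).const_smul (Δ ^ (l + 1))
  have hc : Continuous fun s =>
      evol W (t - s) (Δ ^ (l + 1) • M.lindbladian (dysonTerm LR M.lindbladian ρ l s)) :=
    continuous_evol_comp W (continuous_sub_left t) hcV
  have hVs : ∀ s ∈ Set.Icc 0 t,
      IsSelfAdjoint (Δ ^ (l + 1) • M.lindbladian (dysonTerm LR M.lindbladian ρ l s)) :=
    fun s hs => (IsSelfAdjoint.all (Δ ^ (l + 1))).smul (hLE.isSelfAdjoint (hDs l hs.1))
  have hfs : ∀ s ∈ Set.Icc 0 t, IsSelfAdjoint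
      (evol W (t - s) (Δ ^ (l + 1) • M.lindbladian (dysonTerm LR M.lindbladian ρ l s))) :=
    fun s hs => (hW.preservesNonneg_evol (sub_nonneg.2 hs.2)).isSelfAdjoint (hVs s hs)
  have hZ := isSelfAdjoint_intervalIntegral hc ht hfs
  have hR := hconv.preservesNonneg hLR
  refine ⟨R (∫ s in (0 : ℝ)..t,
    evol W (t - s) (Δ ^ (l + 1) • M.lindbladian (dysonTerm LR M.lindbladian ρ l s))),
    hR.isSelfAdjoint hZ, ?_, ?_⟩
  · rw [evol_eq_dyson_sum_add_integral LR M.lindbladian Δ ρ l t, map_add, ← hWdef]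
    congr 1
    -- Every retained order is correctable, so recovery sees only its trace: one for `k = 0`, zero
    -- otherwise.
    have hRD : ∀ k, k ≤ l → R (dysonTerm LR M.lindbladian ρ k t) =
        tr (dysonTerm LR M.lindbladian ρ k t) • ρ := fun k hk =>
      hconv.apply_eq_tr_smul hLR hcorr hρ
        (errorSpan_mono M ρ hk (dysonTerm_mem_errorSpan hred hρ hk ht)) (hDs k ht)
    have h0 : R (dysonTerm LR M.lindbladian ρ 0 t) = ρ := by
      rw [hRD 0 l.zero_le, dysonTerm, tr_evol_apply hLR.tr_apply, hρ.1.2, one_smul]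
    rw [Finset.sum_range_succ', map_add, pow_zero, one_smul, h0, map_sum,
      Finset.sum_eq_zero, zero_add]
    intro k hk
    rw [← Complex.coe_smul, map_smul, hRD (k + 1) (Finset.mem_range.1 hk),
      tr_dysonTerm_succ hLR.tr_apply M.tr_lindbladian_apply, zero_smul, smul_zero]
  · refine (hR.traceNorm_le (fun A hA => hconv.tr_of_nonneg hLR hA) hZ).trans ?_
    have hg : Continuous fun s : ℝ =>
        Δ ^ (l + 1) * (n * (χ * n / κ) ^ l) * poissonTail l (κ * s) :=
      continuous_const.mul ((continuous_poissonTail l).comp (continuous_const_mul κ))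
    refine (traceNorm_intervalIntegral_le hc hg ht hfs fun s hs => ?_).trans_eq ?_
    · have hs' := Set.Ioo_subset_Icc_self hs
      -- `L_E D_l` may have weight `l + 1`, where recovery gives no decay; contraction under the
      -- full evolution is used instead. This is why the power of `χ` is `l` while that of `Δ` is `l
      -- + 1`.
      have h1 := (hW.preservesNonneg_evol (sub_nonneg.2 hs'.2)).traceNorm_le
        (fun A _ => tr_evol_apply hWtr _ A) (hVs s hs')
      have h2 : traceNorm (M.lindbladian (dysonTerm LR M.lindbladian ρ l s)) ≤
          n * traceNorm (dysonTerm LR M.lindbladian ρ l s) :=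
        traceNorm_le_restrictedNorm_mul _ (supportedIn_of_mem_errorSpan hρ.2
          (dysonTerm_mem_errorSpan hred hρ le_rfl hs'.1))
      have h3 := traceNorm_dysonTerm_le hLR hκ hχ hconv hcorr hred hρ le_rfl hs'.1
      refine h1.trans ?_
      rw [← Complex.coe_smul, traceNorm_smul_of_nonneg (pow_nonneg hΔ _), mul_assoc, mul_assoc]
      exact mul_le_mul_of_nonneg_left (h2.trans (mul_le_mul_of_nonneg_left h3 hn0))
        (pow_nonneg hΔ _)
    · rw [intervalIntegral.integral_const_mul, integral_poissonTail hκ.ne']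
      simp only [div_pow, mul_pow, pow_succ]
      field_simp

end Bounds

/-! ### From the recovered state to the logical error measures -/

section LogicalErrors

variable {H : Type*} [NormedAddCommGroup H] [InnerProductSpace ℂ H] [FiniteDimensional ℂ H]
  [CompleteSpace H] {C : Submodule ℂ H} {ψ : H}

omit [FiniteDimensional ℂ H] in
theorem isStarProjection_ketbra (hψ : ‖ψ‖ = 1) : IsStarProjection (ketbra ψ) :=
  InnerProductSpace.isStarProjection_rankOne_self hψ

omit [CompleteSpace H] in
theorem tr_ketbra (hψ : ‖ψ‖ = 1) : tr (ketbra ψ) = 1 := by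
  have h : tr (ketbra ψ) = inner ℂ ψ ψ := InnerProductSpace.trace_rankOne ψ ψ
  rw [h, inner_self_eq_norm_sq_to_K, hψ]
  simp

omit [CompleteSpace H] in
theorem isCodeState_ketbra (hC : ψ ∈ C) (hψ : ‖ψ‖ = 1) : IsCodeState C (ketbra ψ) := by
  refine ⟨⟨InnerProductSpace.isPositive_rankOne_self ψ, tr_ketbra hψ⟩, fun x => ?_,
    fun x hx => ?_⟩
  · exact C.smul_mem _ hC
  · rw [ketbra, InnerProductSpace.rankOne_apply, (Submodule.mem_orthogonal _ _).1 hx ψ hC,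
      zero_smul]

omit [CompleteSpace H] in
theorem exists_orthonormal_pair (hC : 2 ≤ Module.finrank ℂ C) :
    ∃ ψ₀ ∈ C, ∃ ψ₁ ∈ C, ‖ψ₀‖ = 1 ∧ ‖ψ₁‖ = 1 ∧ inner ℂ ψ₀ ψ₁ = 0 := by
  let b := stdOrthonormalBasis ℂ C
  let i : Fin (Module.finrank ℂ C) := ⟨0, by omega⟩
  let j : Fin (Module.finrank ℂ C) := ⟨1, by omega⟩
  refine ⟨b i, (b i).2, b j, (b j).2, b.norm_eq_one i, b.norm_eq_one j, ?_⟩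
  exact b.orthonormal.2 (i := i) (j := j) (by simp [i, j])

variable {L R : SuperOp H} {t β : ℝ}

theorem epsilon_le (hC : 2 ≤ Module.finrank ℂ C)
    (h : ∀ ψ ∈ C, ‖ψ‖ = 1 → ∃ Y, IsSelfAdjoint Y ∧ R (evol L t (ketbra ψ)) = ketbra ψ + Y ∧
      traceNorm Y ≤ β) : epsilon C L R t ≤ β := by
  rw [epsilon, sub_le_comm]
  obtain ⟨ψ, hψ, -, -, hn, -⟩ := exists_orthonormal_pair hC
  -- The set must be nonempty, since the real infimum of the empty set is `0`; `hC` supplies a unit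
  -- vector.
  refine le_csInf ⟨_, ψ, hψ, hn, rfl⟩ ?_
  rintro _ ⟨ψ, hψ, hn, rfl⟩
  obtain ⟨Y, hY, e, hle⟩ := h ψ hψ hn
  have hP := isStarProjection_ketbra hn
  rw [e, mul_add, hP.isIdempotentElem.eq, tr_add, tr_ketbra hn, Complex.add_re, Complex.one_re]
  linarith [re_tr_mul_le_traceNorm hP hY]

/-- Applying `R` can only decrease the trace distance, so it suffices to distinguish the recovered
states. The reflection in `ψ₀` does so with value at least `2 - ‖Y₀‖₁ - ‖Y₁‖₁`, and half of this is
at least `1 - β`. -/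
theorem delta_le (hC : 2 ≤ Module.finrank ℂ C) (hL : GeneratesPositive L) (ht : 0 ≤ t)
    (hR : PreservesNonneg R) (hRtr : ∀ A, 0 ≤ A → tr (R A) = tr A)
    (h : ∀ ψ ∈ C, ‖ψ‖ = 1 → ∃ Y, IsSelfAdjoint Y ∧ R (evol L t (ketbra ψ)) = ketbra ψ + Y ∧
      traceNorm Y ≤ β) : delta C L t ≤ β := by
  rw [delta, sub_le_comm]
  obtain ⟨ψ₀, hψ₀, ψ₁, hψ₁, hn₀, hn₁, ho⟩ := exists_orthonormal_pair hC
  refine le_csInf ⟨_, ψ₀, hψ₀, ψ₁, hψ₁, hn₀, hn₁, ho, rfl⟩ ?_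
  rintro _ ⟨ψ₀, hψ₀, ψ₁, hψ₁, hn₀, hn₁, ho, rfl⟩
  obtain ⟨Y₀, hY₀, e₀, hle₀⟩ := h ψ₀ hψ₀ hn₀
  obtain ⟨Y₁, hY₁, e₁, hle₁⟩ := h ψ₁ hψ₁ hn₁
  have hP₀ := isStarProjection_ketbra hn₀
  have hP₁ := isStarProjection_ketbra hn₁
  have hs : ∀ φ : H, ‖φ‖ = 1 → IsSelfAdjoint (evol L t (ketbra φ)) := fun φ hφ =>
    (hL.preservesNonneg_evol ht).isSelfAdjoint (isStarProjection_ketbra hφ).isSelfAdjoint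
  have hcontr := hR.traceNorm_le hRtr ((hs ψ₀ hn₀).sub (hs ψ₁ hn₁))
  have horth : ketbra ψ₀ * ketbra ψ₁ = 0 := by
    ext x
    change inner ℂ ψ₀ (inner ℂ ψ₁ x • ψ₁) • ψ₀ = 0
    rw [inner_smul_right, ho, mul_zero, zero_smul]
  rw [map_sub, e₀, e₁] at hcontr
  have hlow := re_tr_reflection_mul_le hP₀
    ((hP₀.isSelfAdjoint.add hY₀).sub (hP₁.isSelfAdjoint.add hY₁))
  -- The `Y₀` term is rewritten with the opposite reflection, so both perturbations carry a minus
  -- sign and the upper bound by the trace norm applies to each.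
  have e : (2 * ketbra ψ₀ - 1) * (ketbra ψ₀ + Y₀ - (ketbra ψ₁ + Y₁)) =
      ketbra ψ₀ + ketbra ψ₁ - (2 * (1 - ketbra ψ₀) - 1) * Y₀ - (2 * ketbra ψ₀ - 1) * Y₁ := by
    have : (2 * ketbra ψ₀ - 1) * (ketbra ψ₀ + Y₀ - (ketbra ψ₁ + Y₁)) =
        2 * (ketbra ψ₀ * ketbra ψ₀) - ketbra ψ₀ - 2 * (ketbra ψ₀ * ketbra ψ₁) + ketbra ψ₁ -
          (2 * (1 - ketbra ψ₀) - 1) * Y₀ - (2 * ketbra ψ₀ - 1) * Y₁ := by noncomm_ring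
    rw [this, horth, hP₀.isIdempotentElem.eq]
    noncomm_ring
  rw [e] at hlow
  simp only [tr_add, tr_sub, Complex.add_re, Complex.sub_re, tr_ketbra hn₀, tr_ketbra hn₁,
    Complex.one_re] at hlow
  have h₀ := re_tr_reflection_mul_le hP₀.one_sub hY₀
  have h₁ := re_tr_reflection_mul_le hP₀ hY₁
  rw [traceDist]
  linarith

end LogicalErrors

end AutonomousQEC

/-! ### Assembly of the bounds -/

open AutonomousQEC in
theorem theorem1 {H : Type*} [NormedAddCommGroup H] [InnerProductSpace ℂ H] [CompleteSpace H]
    [FiniteDimensional ℂ H]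
    (M : ErrorModel H) (C : Submodule ℂ H) (hC : 2 ≤ Module.finrank ℂ C)
    (l : ℕ) (hKL : M.KnillLaflamme C l)
    (LR R : SuperOp H) (hLR : IsLindbladian LR)
    (κ χ : ℝ) (hκ : 0 < κ) (hχ : 0 < χ)
    (hconv : ConvergesTo LR R κ χ)
    (hcorr : M.Corrects C l R)
    (hred : M.StrictlyErrorReducing C l LR)
    (Δ : ℝ) (hΔ : 0 ≤ Δ) (η : ℝ)
    (hη : η = (χ + 1) * Δ * restrictedNorm M.lindbladian (M.errorSpace C l) / κ) :
    (∀ t : ℝ, 0 ≤ t →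
      epsilon C (LR + (Δ : ℂ) • M.lindbladian) R t ≤ 1 / (χ + 1) * η ^ (l + 1) * F l (κ * t) ∧
      delta C (LR + (Δ : ℂ) • M.lindbladian) t ≤ 1 / (χ + 1) * η ^ (l + 1) * F l (κ * t) ∧
      1 / (χ + 1) * η ^ (l + 1) * F l (κ * t) ≤ 1 / (χ + 1) * η ^ (l + 1) * (κ * t)) ∧
    ∀ z : ℝ, 0 ≤ z → F l z ≤ z := by

  set n := restrictedNorm M.lindbladian (M.errorSpace C l) with hn
  have hn0 : 0 ≤ n := restrictedNorm_nonneg _ _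
  -- The prefactor removes one power of `χ + 1`, leaving `(χ + 1) ^ l` to be compared with the `χ ^
  -- l` of the remainder bound.
  have hcoef : 1 / (χ + 1) * η ^ (l + 1) = (χ + 1) ^ l * (Δ * n / κ) ^ (l + 1) := by
    rw [hη, show (χ + 1) * Δ * n / κ = (χ + 1) * (Δ * n / κ) by ring, mul_pow, pow_succ (χ + 1)]
    field_simp
  have hx : 0 ≤ (Δ * n / κ) ^ (l + 1) := by positivity
  refine ⟨fun t ht => ?_, fun z hz => F_le_self l hz⟩
  have hz : 0 ≤ κ * t := mul_nonneg hκ.le ht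
  have key : ∀ ψ ∈ C, ‖ψ‖ = 1 → ∃ Y, IsSelfAdjoint Y ∧
      R (evol (LR + (Δ : ℂ) • M.lindbladian) t (ketbra ψ)) = ketbra ψ + Y ∧
      traceNorm Y ≤ 1 / (χ + 1) * η ^ (l + 1) * F l (κ * t) := fun ψ hψ hψn => by
    obtain ⟨Y, hY, e, hle⟩ := exists_recovered_eq_add hLR hκ hχ hconv hcorr hred
      (isCodeState_ketbra hψ hψn) hΔ ht
    refine ⟨Y, hY, e, hle.trans ?_⟩
    rw [hcoef]
    refine mul_le_mul_of_nonneg_right (mul_le_mul_of_nonneg_right ?_ hx) (F_nonneg l hz)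
    exact pow_le_pow_left₀ hχ.le (le_add_of_nonneg_right zero_le_one) l
  refine ⟨epsilon_le hC key, delta_le hC
    (hLR.generatesPositive.add (M.generatesPositive_lindbladian.smul hΔ)) ht
    (hconv.preservesNonneg hLR) (fun A hA => hconv.tr_of_nonneg hLR hA) key, ?_⟩
  rw [hcoef]
  exact mul_le_mul_of_nonneg_left (F_le_self l hz) (by positivity)
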